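/- Consider assignment problems with $n$ agents and $n$ items, given by an $n\times n$ matrix $u=(u_{ij})$ of real utilities, where every agent $i$ has $u_{ij}>0$ for at least one item $j$. The utilities are *bi-valued* if for each agent $i$ there are $\alpha_i>\beta_i\ge 0$ with $u_{ij}\in\{\alpha_i,\beta_i\}$ for all $j$, and *1-0* if all $u_{ij}\in\{0,1\}$. The *binary-reduced* utilities $u'$ have $u'_{ij}=1$ if $j$ is a most preferred item of $i$ (that is, $u_{ij}=\max_k u_{ik}$) and $u'_{ij}=0$ otherwise. An *assignment* is a matrix $x\in[0,1]^{n\times n}$ with $\sum_i x_{ij}=1$ for all items $j$; its row $x_i$ is the allocation of agent $i$, with utility $u_i(x_i)=\sum_j x_{ij}u_{ij}$ and size $\sum_j x_{ij}$; it is *balanced* if all rows have size $1$. Let $\mathcal A_b$ be the set of vectors in $[0,1]^n$ with coordinate sum $1$ and $\mathcal A=\mathbb R_{\ge0}^n$. A balanced assignment $x$ is an *HZ solution* for $u$ if there are prices $p\in\mathbb R^n_{\ge 0}$ such that, for each $i$, $x_i$ maximizes $u_i(a)$ over all $a\in\mathcal A_b$ with $p\cdot a\le 1$, and $x_i$ has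 least cost $p\cdot a$ among all $a\in\mathcal A_b$ with $u_i(a)\ge u_i(x_i)$. A *CEEI* solution is an assignment $x$ with the same property with $\mathcal A$ in place of $\mathcal A_b$. An *MNW* solution is an assignment maximizing $\prod_i u_i(x_i)$ over all assignments. A *leximin* solution is an assignment whose vector of utilities, sorted in nondecreasing order, is lexicographically maximal among all assignments. The *balancing operation* on an assignment $x$ is: each agent whose allocation has size greater than $1$ gives away least preferred items of her allocation until it has size $1$; the donated items are then distributed, arbitrarily, to the agents whose allocations have size less than $1$, so that all allocations have size $1$. Work on a random access machine with real-number cells, in which each elementary instruction or comparison (on numbers: setting to $0$ or $1$, copying, addition, subtraction, comparison) costs one step. Then there is a reduction, running in time linear in the input size (that is, $O(n^2)$ steps for the $n\times n$ matrix $u$, not counting the time of the solver), from computing an HZ solution under bi-valued utilities to computing an MNW, CEEI or leximin solution under 1-0 utilities. Given bi-valued $u$: 1. it computes the binary-reduced utilities $u'$, which are 1-0 utilities in which each agent has positive utility for at least one item; 2. it makes one call to the solver on $u'$ and receives a solution $x$ of $u'$ (an arbitrary MNW solution, an arbitrary CEEI solution, or an arbitrary leximin solution); 3. it outputs a result of the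 balancing operation on $x$, and this output is an HZ solution for the original utilities $u$. Moreover, every possible result of the balancing operation on such an $x$ is an HZ solution for $u$. -/

import Mathlib

open scoped BigOperators

namespace HZReduction

/-! ### Assignment problems -/

/-- An `n × n` array of reals, used for utility profiles (`u i j` is the utility of agent `i` for
item `j`) and for fractional assignments (`x i j` is the fraction of item `j` given to `i`). -/
abbrev Profile (n : ℕ) := Fin n → Fin n → ℝ

/-- Additive value of the bundle `a` when `v j` is the value (or the price) of item `j`. -/
def value {n : ℕ} (v a : Fin n → ℝ) : ℝ := ∑ j, a j * v j

/-- The size of an allocation. -/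
def size {n : ℕ} (a : Fin n → ℝ) : ℝ := ∑ j, a j

/-- Fractional assignments: entries in `[0,1]`, every item completely allocated. -/
structure IsAssignment {n : ℕ} (x : Profile n) : Prop where
  nonneg : ∀ i j, 0 ≤ x i j
  le_one : ∀ i j, x i j ≤ 1
  col_sum : ∀ j, ∑ i, x i j = 1

/-- Balanced assignments: every agent receives exactly one unit. -/
def IsBalanced {n : ℕ} (x : Profile n) : Prop := ∀ i, size (x i) = 1

/-- Bi-valued utilities: `u i j ∈ {α i, β i}` with `α i > β i ≥ 0`. -/
def IsBiValued {n : ℕ} (u : Profile n) : Prop :=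
  ∃ α β : Fin n → ℝ, ∀ i, 0 ≤ β i ∧ β i < α i ∧ ∀ j, u i j = α i ∨ u i j = β i

/-- 1-0 utilities. -/
def IsBinary {n : ℕ} (u : Profile n) : Prop := ∀ i j, u i j = 0 ∨ u i j = 1

/-- `j ∈ D_i`: item `j` is among the items most preferred by agent `i`. -/
def MostPreferred {n : ℕ} (u : Profile n) (i j : Fin n) : Prop := ∀ k, u i k ≤ u i j

open Classical in
/-- Binary-reduced utilities: the higher value of each agent becomes 1 and the lower one 0
(see `binaryReduced_eq`). The higher value is the one of the most preferred items, so an agent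
who values all items equally has reduced utility 1 for all of them. -/
noncomputable def binaryReduced {n : ℕ} (u : Profile n) : Profile n :=
  fun i j => if MostPreferred u i j then 1 else 0

open Classical in
theorem binaryReduced_eq {n : ℕ} (u : Profile n) (i : Fin n) (a b : ℝ) (hab : b < a)
    (hu : ∀ j, u i j = a ∨ u i j = b) (ha : ∃ j, u i j = a) (j : Fin n) :
    binaryReduced u i j = if u i j = a then 1 else 0 := by
  have h : MostPreferred u i j ↔ u i j = a := by
    constructor
    · intro hj
      obtain ⟨k, hk⟩ := ha
      rcases hu j with h | h
      · exact h
      · have := hj k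
        linarith
    · intro hj k
      rcases hu k with h | h <;> linarith
  simp only [binaryReduced, h]

/-! ### Solution concepts -/

/-- Balanced allocations of a single agent. -/
def balancedAllocations (n : ℕ) : Set (Fin n → ℝ) :=
  {a | (∀ j, 0 ≤ a j ∧ a j ≤ 1) ∧ size a = 1}

/-- Allocations of a single agent, with no limit on the amounts consumed. -/
def allocations (n : ℕ) : Set (Fin n → ℝ) := {a | ∀ j, 0 ≤ a j}

/-- At prices `p`, every agent with budget 1 receives a utility-maximal affordable bundle from the
consumption set `S`, and one that is cheapest among the bundles in `S` of at least that utility. -/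
def IsDemandedAt {n : ℕ} (S : Set (Fin n → ℝ)) (u x : Profile n) (p : Fin n → ℝ) : Prop :=
  ∀ i, x i ∈ S ∧ value p (x i) ≤ 1 ∧
    (∀ a ∈ S, value p a ≤ 1 → value (u i) a ≤ value (u i) (x i)) ∧
    (∀ a ∈ S, value (u i) (x i) ≤ value (u i) a → value p (x i) ≤ value p a)

/-- Hylland–Zeckhauser solutions. -/
def IsHZ {n : ℕ} (u x : Profile n) : Prop :=
  IsAssignment x ∧ IsBalanced x ∧
    ∃ p : Fin n → ℝ, (∀ j, 0 ≤ p j) ∧ IsDemandedAt (balancedAllocations n) u x p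

/-- Competitive equilibrium with equal incomes. -/
def IsCEEI {n : ℕ} (u x : Profile n) : Prop :=
  IsAssignment x ∧
    ∃ p : Fin n → ℝ, (∀ j, 0 ≤ p j) ∧ IsDemandedAt (allocations n) u x p

/-- Assignments of maximum Nash welfare. -/
def IsMNW {n : ℕ} (u x : Profile n) : Prop :=
  IsAssignment x ∧
    ∀ y, IsAssignment y → ∏ i, value (u i) (y i) ≤ ∏ i, value (u i) (x i)

/-- The entries of `v`, arranged in nondecreasing order. -/
noncomputable def sorted {n : ℕ} (v : Fin n → ℝ) : Fin n → ℝ := v ∘ Tuple.sort v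

/-- `v` leximin-dominates `w`. -/
def LeximinDominates {n : ℕ} (v w : Fin n → ℝ) : Prop :=
  ∃ i, (∀ j, j < i → sorted v j = sorted w j) ∧ sorted w i < sorted v i

/-- Leximin optimal assignments. -/
def IsLeximin {n : ℕ} (u x : Profile n) : Prop :=
  IsAssignment x ∧
    ∀ y, IsAssignment y →
      ¬ LeximinDominates (fun i => value (u i) (y i)) (fun i => value (u i) (x i))

/-- `y` is a possible result of the balancing operation on `x`: agents holding more than one unit
give away least preferred parts of their allocation until one unit is left, and the donated
items are distributed, arbitrarily, to the agents holding less than one unit, to bring each of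
them to one unit. (A row of size one is left unchanged.) -/
structure IsBalancing {n : ℕ} (u x y : Profile n) : Prop where
  assignment : IsAssignment y
  balanced : IsBalanced y
  gives : ∀ i, 1 ≤ size (x i) → ∀ j, y i j ≤ x i j
  least_first : ∀ i, 1 ≤ size (x i) → ∀ j k, u i k < u i j → y i j < x i j → y i k = 0
  receives : ∀ i, size (x i) ≤ 1 → ∀ j, x i j ≤ y i j

/-! ### A random access machine with real numbers

Programs are finite syntactic objects. The machine has index registers holding natural numbers and
two-dimensional arrays of real numbers, whose cells are addressed by pairs of index registers.
Every instruction and every test costs one step. Index registers can only be cleared, copied,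
incremented and compared; numbers can only be set to 0 or 1, copied, added, subtracted and
compared. -/

/-- Machine states: `idx r` is the content of index register `r` and `num a k l` is the entry
`(k, l)` of array `a`. -/
structure State where
  idx : ℕ → ℕ
  num : ℕ → ℕ → ℕ → ℝ

/-- The name of a number cell: array `arr`, at the position given by the contents of the index
registers `row` and `col`. -/
structure Cell where
  arr : ℕ
  row : ℕ
  col : ℕ

/-- Content of a cell. -/
def State.get (σ : State) (c : Cell) : ℝ := σ.num c.arr (σ.idx c.row) (σ.idx c.col)

/-- Overwrite a cell. -/
noncomputable def State.set (σ : State) (c : Cell) (v : ℝ) : State where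
  idx := σ.idx
  num := fun a k l =>
    if a = c.arr ∧ k = σ.idx c.row ∧ l = σ.idx c.col then v else σ.num a k l

/-- Overwrite an index register. -/
def State.setIdx (σ : State) (r m : ℕ) : State where
  idx := fun s => if s = r then m else σ.idx s
  num := σ.num

/-- Elementary instructions; the first argument is the destination. -/
inductive Instr where
  | idxZero (r : ℕ)
  | idxCopy (r s : ℕ)
  | idxInc (r : ℕ)
  | numZero (c : Cell)
  | numOne (c : Cell)
  | numCopy (c d : Cell)
  | numPlus (c d e : Cell)
  | numMinus (c d e : Cell)

/-- Effect of an elementary instruction. -/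
noncomputable def Instr.run : Instr → State → State
  | .idxZero r, σ => σ.setIdx r 0
  | .idxCopy r s, σ => σ.setIdx r (σ.idx s)
  | .idxInc r, σ => σ.setIdx r (σ.idx r + 1)
  | .numZero c, σ => σ.set c 0
  | .numOne c, σ => σ.set c 1
  | .numCopy c d, σ => σ.set c (σ.get d)
  | .numPlus c d e, σ => σ.set c (σ.get d + σ.get e)
  | .numMinus c d e, σ => σ.set c (σ.get d - σ.get e)

/-- Tests: strict comparison of two index registers or of two numbers. -/
inductive Test where
  | idxLt (r s : ℕ)
  | numLt (c d : Cell)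

/-- Outcome of a test. -/
def Test.Holds : Test → State → Prop
  | .idxLt r s, σ => σ.idx r < σ.idx s
  | .numLt c d, σ => σ.get c < σ.get d

/-- Programs. -/
inductive Prog where
  | skip
  | instr (i : Instr)
  | seq (P Q : Prog)
  | branch (b : Test) (P Q : Prog)
  | loop (b : Test) (P : Prog)

/-- `Exec P σ t τ`: started in state `σ`, program `P` halts after `t` steps in state `τ`. -/
inductive Exec : Prog → State → ℕ → State → Prop where
  | skip (σ : State) : Exec .skip σ 1 σ
  | instr (i : Instr) (σ : State) : Exec (.instr i) σ 1 (i.run σ)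
  | seq {P Q : Prog} {σ τ ρ : State} {s t : ℕ} :
      Exec P σ s τ → Exec Q τ t ρ → Exec (.seq P Q) σ (s + t) ρ
  | branch_true {b : Test} {P Q : Prog} {σ τ : State} {t : ℕ} :
      b.Holds σ → Exec P σ t τ → Exec (.branch b P Q) σ (t + 1) τ
  | branch_false {b : Test} {P Q : Prog} {σ τ : State} {t : ℕ} :
      ¬ b.Holds σ → Exec Q σ t τ → Exec (.branch b P Q) σ (t + 1) τ
  | loop_true {b : Test} {P : Prog} {σ τ ρ : State} {s t : ℕ} :
      b.Holds σ → Exec P σ s τ → Exec (.loop b P) τ t ρ → Exec (.loop b P) σ (s + t + 1) ρ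
  | loop_false {b : Test} {P : Prog} {σ : State} :
      ¬ b.Holds σ → Exec (.loop b P) σ 1 σ

/-- Store an `n × n` matrix in array `a`; the rest of that array is cleared. -/
noncomputable def State.store {n : ℕ} (σ : State) (a : ℕ) (x : Profile n) : State where
  idx := σ.idx
  num := fun b k l =>
    if b = a then (if h : k < n ∧ l < n then x ⟨k, h.1⟩ ⟨l, h.2⟩ else 0) else σ.num b k l

/-- The `n × n` matrix held in array `a`. -/
def State.read (σ : State) (n a : ℕ) : Profile n := fun i j => σ.num a i j

/-- Initial state on input `u`: `n` is in index register 0 and `u` is in array 0; all other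
registers and cells contain 0. -/
noncomputable def State.init {n : ℕ} (u : Profile n) : State :=
  State.store ⟨fun r => if r = 0 then n else 0, fun _ _ _ => 0⟩ 0 u

end HZReduction

open HZReduction

/-! For 1-0 utilities `v`, each of the three solution concepts implies `IsFair`, and fairness is all
the argument needs. MNW and leximin give it through two exchange moves (`isFair_of_unimprovable`),
CEEI through its prices.

Let `x` be fair, with utilities `U i`, and let `y` be any balancing of it. An agent with `U i ≥ 1`
ends with one unit of liked items. An agent with `U i < 1` keeps exactly the liked amounts held in
`x`: liked items are never given up before useless ones, and by fairness anyone who likes a donated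
item has utility at least 1. Price an item at `(U k)⁻¹` if a holder `k` with `U k < 1` likes it, and
at 0 otherwise; fairness makes this independent of `k`. Agents with `U i ≥ 1` then pay nothing and
have utility 1, the most a unit bundle offers. For the others every liked item costs at least `(U
i)⁻¹`, with equality on those held, and the filler is free; they spend exactly 1 and cannot do
better or cheaper (`IsBalancing.isHZ`).

A bi-valued row is an increasing affine function of its binary reduction, so both rank balanced
allocations alike, and the conclusion carries over to `u`.

The running time is handled by a Hoare-style calculus `Runs` with step bounds. One program compares
each entry with its row maximum; the other moves excess into a pool, useless items first, and then
fills the deficient rows from the pool. -/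

namespace HZReduction

variable {n : ℕ}

/-- Pareto optimality and proportionality of an assignment for 1-0 utilities, in terms of single
transfers: no item is held by an agent without use for it while another agent likes it, and nobody
likes an item held by an agent of higher utility. -/
structure IsFair (v x : Profile n) : Prop where
  assignment : IsAssignment x
  pos : ∀ i, 0 < value (v i) (x i)
  useful : ∀ k j, 0 < x k j → v k j = 0 → ∀ i, v i j = 0
  le : ∀ i k j, 0 < x k j → v i j = 1 → value (v k) (x k) ≤ value (v i) (x i)

/-- On allocations of size 1 the constant `b` contributes equally, so for `d > 0` both utilities
induce the same preferences. -/
theorem value_affine {w v a : Fin n → ℝ} {b d : ℝ} (h : ∀ j, w j = b + d * v j) :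
    value w a = b * size a + d * value v a := by
  simp only [value, size, h, Finset.mul_sum, ← Finset.sum_add_distrib]
  exact Finset.sum_congr rfl fun j _ => by ring

theorem value_le_size {v a : Fin n → ℝ} (hv : ∀ j, v j = 0 ∨ v j = 1) (ha : ∀ j, 0 ≤ a j) :
    value v a ≤ size a := by
  refine Finset.sum_le_sum fun j _ => ?_
  rcases hv j with h | h <;> simp [h, ha j]

theorem value_nonneg {v a : Fin n → ℝ} (hv : ∀ j, 0 ≤ v j) (ha : ∀ j, 0 ≤ a j) :
    0 ≤ value v a :=
  Finset.sum_nonneg fun j _ => mul_nonneg (ha j) (hv j)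

theorem IsBinary.nonneg {v : Profile n} (hv : IsBinary v) (i j : Fin n) : 0 ≤ v i j := by
  rcases hv i j with h | h <;> simp [h]

theorem exists_donor {x y : Profile n} (hx : IsAssignment x) (hy : IsAssignment y) {i j : Fin n}
    (h : x i j < y i j) : ∃ k, y k j < x k j := by
  by_contra! hc
  have := Finset.sum_lt_sum (s := Finset.univ) (f := fun k => x k j) (g := fun k => y k j)
    (fun k _ => hc k) ⟨i, Finset.mem_univ _, h⟩
  rw [hx.col_sum, hy.col_sum] at this
  exact lt_irrefl _ this

/-! ### Balancing a fair assignment yields an HZ solution -/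

section Balancing

variable {u v x y : Profile n} {b d : Fin n → ℝ}

/-- Keeping a useless item means that no liked item was given away; the liked part alone then has
size at least 1, so the row would exceed size 1. -/
theorem balancing_of_one_le (hv : IsBinary v) (hd : ∀ i, 0 < d i)
    (hu : ∀ i j, u i j = b i + d i * v i j) (hx : IsAssignment x) (hb : IsBalancing u x y)
    {i : Fin n} (hi : 1 ≤ value (v i) (x i)) {j : Fin n} (hj : 0 < y i j) : v i j = 1 := by
  rcases hv i j with h0 | h1
  swap
  · exact h1
  exfalso
  have hs : 1 ≤ size (x i) := hi.trans (value_le_size (hv i) (hx.nonneg i))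
  have hxy : ∀ l, v i l = 1 → x i l ≤ y i l := by
    intro l hl
    by_contra! hlt
    have hul : u i j < u i l := by rw [hu, hu, h0, hl]; linarith [hd i]
    exact hj.ne' (hb.least_first i hs l j hul hlt)
  have hlt : value (v i) (x i) < size (y i) := by
    refine Finset.sum_lt_sum (fun l _ => ?_) ⟨j, Finset.mem_univ _, by simpa [h0] using hj⟩
    rcases hv i l with h | h
    · simpa [h] using hb.assignment.nonneg i l
    · simpa [h] using hxy l h
  rw [hb.balanced i] at hlt
  linarith

/-- Giving up a liked item requires that all useless ones are gone, which would leave size at most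
the old utility, less than 1. -/
theorem balancing_eq_of_one_le_size (hv : IsBinary v) (hd : ∀ i, 0 < d i)
    (hu : ∀ i j, u i j = b i + d i * v i j) (hb : IsBalancing u x y)
    {i : Fin n} (hi : value (v i) (x i) < 1) (hs : 1 ≤ size (x i)) {j : Fin n}
    (hj : v i j = 1) : y i j = x i j := by
  refine le_antisymm (hb.gives i hs j) ?_
  by_contra! hlt
  have h0 : ∀ l, v i l = 0 → y i l = 0 := fun l hl =>
    hb.least_first i hs j l (by rw [hu, hu, hj, hl]; linarith [hd i]) hlt
  have hle : size (y i) ≤ value (v i) (x i) := by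
    refine Finset.sum_le_sum fun l _ => ?_
    rcases hv i l with h | h
    · simp [h, h0 l h]
    · simpa [h] using hb.gives i hs l
  rw [hb.balanced i] at hle
  linarith

/-- A donor of utility at least 1 passes this bound to everyone who likes the item, by fairness. A
donor of lower utility gives only items useless to herself, hence useless to all. -/
theorem one_le_of_donated (hv : IsBinary v) (hd : ∀ i, 0 < d i)
    (hu : ∀ i j, u i j = b i + d i * v i j) (hx : IsFair v x) (hb : IsBalancing u x y)
    {i k j : Fin n} (hk : y k j < x k j) (hj : v i j = 1) : 1 ≤ value (v i) (x i) := by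
  have hpos : 0 < x k j := (hb.assignment.nonneg k j).trans_lt hk
  rcases le_or_gt 1 (value (v k) (x k)) with h | h
  · exact h.trans (hx.le i k j hpos hj)
  · exfalso
    rcases le_or_gt 1 (size (x k)) with hs | hs
    · rcases hv k j with h0 | h1
      · simpa [hj] using hx.useful k j hpos h0 i
      · exact hk.ne (balancing_eq_of_one_le_size hv hd hu hb h hs h1)
    · exact absurd (hb.receives k hs.le j) (not_le.2 hk)

theorem balancing_eq_of_lt_one (hv : IsBinary v) (hd : ∀ i, 0 < d i)
    (hu : ∀ i j, u i j = b i + d i * v i j) (hx : IsFair v x) (hb : IsBalancing u x y)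
    {i : Fin n} (hi : value (v i) (x i) < 1) {j : Fin n} (hj : v i j = 1) : y i j = x i j := by
  rcases le_or_gt 1 (size (x i)) with hs | hs
  · exact balancing_eq_of_one_le_size hv hd hu hb hi hs hj
  · refine (le_antisymm (hb.receives i hs.le j) ?_).symm
    by_contra! hlt
    obtain ⟨k, hk⟩ := exists_donor hx.assignment hb.assignment hlt
    exact absurd (one_le_of_donated hv hd hu hx hb hk hj) (not_le.2 hi)

open Classical in
/-- Equilibrium prices: an item liked by one of its holders `k` of utility below 1 costs the inverse
of that utility, all other items are free. -/
noncomputable def price (v x : Profile n) (j : Fin n) : ℝ :=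
  if h : ∃ k, 0 < x k j ∧ v k j = 1 ∧ value (v k) (x k) < 1 then
    (value (v h.choose) (x h.choose))⁻¹ else 0

/-- Two agents who both hold and like the same item have equal utilities, so the chosen holder does
not matter. -/
theorem price_eq (hx : IsFair v x) {k j : Fin n} (h1 : 0 < x k j) (h2 : v k j = 1)
    (h3 : value (v k) (x k) < 1) : price v x j = (value (v k) (x k))⁻¹ := by
  have h : ∃ k, 0 < x k j ∧ v k j = 1 ∧ value (v k) (x k) < 1 := ⟨k, h1, h2, h3⟩
  rw [price, dif_pos h]
  congr 1
  exact le_antisymm (hx.le _ _ _ h.choose_spec.1 h2) (hx.le _ _ _ h1 h.choose_spec.2.1)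

theorem price_eq_zero {j : Fin n} (h : ∀ k, 0 < x k j → v k j = 1 → 1 ≤ value (v k) (x k)) :
    price v x j = 0 := by
  rw [price, dif_neg]
  rintro ⟨k, h1, h2, h3⟩
  exact absurd (h k h1 h2) (not_le.2 h3)

theorem price_nonneg (hx : IsFair v x) (j : Fin n) : 0 ≤ price v x j := by
  rw [price]
  split_ifs with h
  · exact (inv_pos.2 (hx.pos _)).le
  · exact le_rfl

/-- Some agent holds `j`, must like it because `i` does, and has utility at most that of `i`; the
price is the inverse of that smaller utility. -/
theorem inv_le_price (hv : IsBinary v) (hx : IsFair v x) {i j : Fin n}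
    (hi : value (v i) (x i) < 1) (hj : v i j = 1) : (value (v i) (x i))⁻¹ ≤ price v x j := by
  obtain ⟨k, hk⟩ : ∃ k, 0 < x k j := by
    by_contra! hc
    have h := Finset.sum_nonpos (s := Finset.univ) (f := fun k => x k j) fun k _ => hc k
    rw [hx.assignment.col_sum] at h
    linarith
  have hkj : v k j = 1 := by
    rcases hv k j with h | h
    · simpa [hj] using hx.useful k j hk h i
    · exact h
  have hle := hx.le i k j hk hj
  rw [price_eq hx hk hkj (hle.trans_lt hi)]
  exact inv_anti₀ (hx.pos k) hle

/-- If `i` already held `j` in `x`, nobody likes it; otherwise it was donated, and all who like it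
have utility at least 1. -/
theorem price_eq_zero_of_balancing (hv : IsBinary v) (hd : ∀ i, 0 < d i)
    (hu : ∀ i j, u i j = b i + d i * v i j) (hx : IsFair v x) (hb : IsBalancing u x y)
    {i j : Fin n} (hj : 0 < y i j) (h0 : v i j = 0) : price v x j = 0 := by
  refine price_eq_zero fun k hk hkj => ?_
  have hxi : x i j = 0 := by
    refine le_antisymm ?_ (hx.assignment.nonneg i j)
    by_contra! hc
    simpa [hkj] using hx.useful i j hc h0 k
  obtain ⟨l, hl⟩ := exists_donor hx.assignment hb.assignment (hxi.trans_lt hj)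
  exact one_le_of_donated hv hd hu hx hb hl hkj

theorem IsBalancing.isHZ (hv : IsBinary v) (hd : ∀ i, 0 < d i)
    (hu : ∀ i j, u i j = b i + d i * v i j) (hx : IsFair v x) (hb : IsBalancing u x y) :
    IsHZ u y := by
  have hmem : ∀ i, y i ∈ balancedAllocations n := fun i =>
    ⟨fun j => ⟨hb.assignment.nonneg i j, hb.assignment.le_one i j⟩, hb.balanced i⟩
  refine ⟨hb.assignment, hb.balanced, price v x, price_nonneg hx, fun i => ⟨hmem i, ?_⟩⟩
  have hval : ∀ {a c : Fin n → ℝ}, a ∈ balancedAllocations n → c ∈ balancedAllocations n →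
      (value (u i) a ≤ value (u i) c ↔ value (v i) a ≤ value (v i) c) := by
    intro a c ha hc
    rw [value_affine (hu i), value_affine (hu i), ha.2, hc.2, add_le_add_iff_left,
      mul_le_mul_iff_right₀ (hd i)]
  rcases le_or_gt 1 (value (v i) (x i)) with hi | hi
  · have hy1 : value (v i) (y i) = 1 := by
      rw [← hb.balanced i]
      refine Finset.sum_congr rfl fun j _ => ?_
      rcases (hb.assignment.nonneg i j).eq_or_lt with h | h
      · simp [← h]
      · simp [balancing_of_one_le hv hd hu hx.assignment hb hi h]
    -- Everything in `y i` was already in `x i`, so anyone who likes it is at least as well off as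
    -- `i`.
    have hc : value (price v x) (y i) = 0 := by
      refine Finset.sum_eq_zero fun j _ => ?_
      rcases (hb.assignment.nonneg i j).eq_or_lt with h | h
      · simp [← h]
      · have hs : 1 ≤ size (x i) := hi.trans (value_le_size (hv i) (hx.assignment.nonneg i))
        have hxj : 0 < x i j := h.trans_le (hb.gives i hs j)
        rw [price_eq_zero fun k _ hkj => hi.trans (hx.le k i j hxj hkj), mul_zero]
    refine ⟨by rw [hc]; exact zero_le_one, fun a ha _ => ?_, fun a ha _ => ?_⟩
    · rw [hval ha (hmem i), hy1, ← ha.2]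
      exact value_le_size (hv i) fun j => (ha.1 j).1
    · rw [hc]
      exact value_nonneg (price_nonneg hx) fun j => (ha.1 j).1
  · have hpos := hx.pos i
    have hyx : value (v i) (y i) = value (v i) (x i) := by
      refine Finset.sum_congr rfl fun j _ => ?_
      rcases hv i j with h | h
      · simp [h]
      · rw [balancing_eq_of_lt_one hv hd hu hx hb hi h]
    have hc : value (price v x) (y i) = 1 := by
      have : value (price v x) (y i) = ∑ j, x i j * v i j * (value (v i) (x i))⁻¹ := by
        refine Finset.sum_congr rfl fun j _ => ?_
        rcases hv i j with h | h
        · rcases (hb.assignment.nonneg i j).eq_or_lt with h' | h'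
          · simp [← h', h]
          · simp [h, price_eq_zero_of_balancing hv hd hu hx hb h' h]
        · rw [balancing_eq_of_lt_one hv hd hu hx hb hi h]
          rcases (hx.assignment.nonneg i j).eq_or_lt with h' | h'
          · simp [← h']
          · rw [price_eq hx h' h hi, h, mul_one]
      rw [this, ← Finset.sum_mul]
      exact mul_inv_cancel₀ hpos.ne'
    -- A unit of utility costs at least the inverse of the utility of `i`. This bounds both the
    -- affordable utility and the cost of matching it.
    have hcost : ∀ a ∈ balancedAllocations n,
        value (v i) a * (value (v i) (x i))⁻¹ ≤ value (price v x) a := by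
      intro a ha
      rw [value, Finset.sum_mul]
      refine Finset.sum_le_sum fun j _ => ?_
      rcases hv i j with h | h
      · simpa [h] using mul_nonneg (ha.1 j).1 (price_nonneg hx j)
      · rw [h, mul_one]
        exact mul_le_mul_of_nonneg_left (inv_le_price hv hx hi h) (ha.1 j).1
    refine ⟨hc.le, fun a ha hp => ?_, fun a ha hua => ?_⟩
    · rw [hval ha (hmem i), hyx]
      have := (hcost a ha).trans hp
      rwa [← div_eq_mul_inv, div_le_one hpos] at this
    · rw [hval (hmem i) ha, hyx] at hua
      rw [hc]
      refine le_trans ?_ (hcost a ha)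
      rwa [← div_eq_mul_inv, one_le_div hpos]

end Balancing

/-! ### Bi-valued utilities and their binary reduction -/

theorem IsBiValued.exists_affine {u : Profile n} (hu : IsBiValued u) :
    ∃ b d : Fin n → ℝ, (∀ i, 0 < d i) ∧ ∀ i j, u i j = b i + d i * binaryReduced u i j := by
  obtain ⟨α, β, h⟩ := hu
  have : ∀ i, ∃ b d : ℝ, 0 < d ∧ ∀ j, u i j = b + d * binaryReduced u i j := by
    intro i
    obtain ⟨-, hlt, hj⟩ := h i
    by_cases ha : ∃ j, u i j = α i
    · refine ⟨β i, α i - β i, by linarith, fun j => ?_⟩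
      rw [binaryReduced_eq u i _ _ hlt hj ha]
      split_ifs with h1
      · rw [h1]; ring
      · rw [(hj j).resolve_left h1]; ring
    · have hβ : ∀ j, u i j = β i := fun j => (hj j).resolve_left fun h => ha ⟨j, h⟩
      -- If the higher value never occurs, the reduced row is constantly 1, and slope 1 with this
      -- intercept returns `β i`.
      refine ⟨β i - 1, 1, one_pos, fun j => ?_⟩
      have hm : MostPreferred u i j := fun k => (by rw [hβ, hβ])
      rw [binaryReduced, if_pos hm, hβ]
      ring
  choose b d hd hu using this
  exact ⟨b, d, hd, hu⟩

theorem isBinary_binaryReduced (u : Profile n) : IsBinary (binaryReduced u) := by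
  intro i j
  rw [binaryReduced]
  split_ifs <;> simp

theorem exists_binaryReduced_eq_one (u : Profile n) (i : Fin n) :
    ∃ j, binaryReduced u i j = 1 := by
  obtain ⟨j, -, hj⟩ := Finset.exists_max_image Finset.univ (u i) ⟨i, Finset.mem_univ _⟩
  exact ⟨j, if_pos fun k => hj k (Finset.mem_univ _)⟩

/-! ### Solutions for 1-0 utilities are fair -/

/-- Give `ε` units of item `j`, held by agent `k`, to agent `i`. -/
noncomputable def transfer (x : Profile n) (i k j : Fin n) (ε : ℝ) : Profile n := fun a l =>
  x a l + if l = j then (if a = i then ε else 0) - (if a = k then ε else 0) else 0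

theorem value_transfer (v x : Profile n) (i k j : Fin n) (ε : ℝ) (a : Fin n) :
    value (v a) (transfer x i k j ε a) =
      value (v a) (x a) + ((if a = i then ε else 0) - (if a = k then ε else 0)) * v a j := by
  simp [value, transfer, add_mul, Finset.sum_add_distrib, ite_mul]

theorem IsAssignment.transfer {x : Profile n} (hx : IsAssignment x) {i k j : Fin n} {ε : ℝ}
    (hik : i ≠ k) (h0 : 0 ≤ ε) (hε : ε ≤ x k j) : IsAssignment (transfer x i k j ε) := by
  have hnn : ∀ a l, 0 ≤ HZReduction.transfer x i k j ε a l := by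
    intro a l
    have := hx.nonneg a l
    simp only [HZReduction.transfer]
    split_ifs with h1 h2 h3 h3
    · exact absurd (h2.symm.trans h3) hik
    · linarith
    · rw [h1, h3]; linarith
    · linarith
    · linarith
  have hcol : ∀ l, ∑ a, HZReduction.transfer x i k j ε a l = 1 := by
    intro l
    simp only [HZReduction.transfer, Finset.sum_add_distrib, hx.col_sum]
    by_cases h : l = j <;> simp [h]
  refine ⟨hnn, fun a l => ?_, hcol⟩
  rw [← hcol l]
  exact Finset.single_le_sum (f := fun a => HZReduction.transfer x i k j ε a l)
    (fun a _ => hnn a l) (Finset.mem_univ a)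

/-- The equal division of all items. -/
theorem isAssignment_uniform [NeZero n] : IsAssignment (fun _ _ : Fin n => (n : ℝ)⁻¹) := by
  have hn : (1 : ℝ) ≤ n := by exact_mod_cast NeZero.one_le
  refine ⟨fun _ _ => by positivity, fun _ _ => inv_le_one_of_one_le₀ hn, fun _ => ?_⟩
  simp [mul_inv_cancel₀ (show (n : ℝ) ≠ 0 by positivity)]

theorem value_pos_of_uniform [NeZero n] {v : Profile n} (hv : IsBinary v)
    (h1 : ∀ i, ∃ j, v i j = 1) (i : Fin n) : 0 < value (v i) (fun _ => (n : ℝ)⁻¹) := by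
  have hn : (0 : ℝ) < n := by exact_mod_cast NeZero.pos n
  obtain ⟨j, hj⟩ := h1 i
  refine Finset.sum_pos' (fun l _ => mul_nonneg (by positivity) (hv.nonneg i l))
    ⟨j, Finset.mem_univ _, ?_⟩
  rw [hj]
  positivity

/-- An assignment with positive utilities is fair if it cannot be improved by raising the utility of
one agent, nor by shifting utility from an agent to one of lower utility. -/
theorem isFair_of_unimprovable {v x : Profile n} (hv : IsBinary v) (hx : IsAssignment x)
    (hpos : ∀ i, 0 < value (v i) (x i))
    (hraise : ∀ y, IsAssignment y → ∀ i, value (v i) (x i) < value (v i) (y i) →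
      (∀ a, a ≠ i → value (v a) (y a) = value (v a) (x a)) → False)
    (hshift : ∀ y, IsAssignment y → ∀ i k ε, 0 < ε →
      ε < value (v k) (x k) - value (v i) (x i) →
      value (v i) (y i) = value (v i) (x i) + ε →
      value (v k) (y k) = value (v k) (x k) - ε →
      (∀ a, a ≠ i → a ≠ k → value (v a) (y a) = value (v a) (x a)) → False) :
    IsFair v x := by
  have huse : ∀ k j, 0 < x k j → v k j = 0 → ∀ i, v i j = 0 := by
    intro k j hk h0 i
    rcases hv i j with h | h1
    · exact h
    exfalso
    have hik : i ≠ k := by rintro rfl; simp [h0] at h1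
    -- Handing over the whole share costs `k` nothing, since `j` is useless to `k`.
    refine hraise _ (hx.transfer hik hk.le le_rfl) i ?_ fun a ha => ?_
    · rw [value_transfer]
      simpa [hik, h1] using hk
    · rw [value_transfer]
      by_cases hak : a = k
      · simp [hak, h0]
      · simp [ha, hak]
  refine ⟨hx, hpos, huse, fun i k j hk h1 => ?_⟩
  by_contra! hlt
  have hik : i ≠ k := by rintro rfl; exact lt_irrefl _ hlt
  have hkj : v k j = 1 := by
    rcases hv k j with h | h
    · simpa [h1] using huse k j hk h i
    · exact h
  set δ := value (v k) (x k) - value (v i) (x i) with hδ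
  have hδ0 : 0 < δ := sub_pos.2 hlt
  -- The amount must be available and strictly less than the utility gap.
  have hε0 : 0 < min (x k j) (δ / 2) := lt_min hk (half_pos hδ0)
  refine hshift _ (hx.transfer hik hε0.le (min_le_left _ _)) i k (min (x k j) (δ / 2)) hε0
    ((min_le_right _ _).trans_lt (half_lt_self hδ0)) ?_ ?_ fun a hai hak => ?_
  · simp [value_transfer, hik, h1]
  · simp [value_transfer, hik.symm, hkj, sub_eq_add_neg]
  · simp [value_transfer, hai, hak]

/-- The equal division has positive Nash welfare, so all utilities at an optimum are positive.
Raising one factor, or bringing two factors closer at constant sum, would then increase the product.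
-/
theorem IsMNW.isFair {v x : Profile n} (hv : IsBinary v) (h1 : ∀ i, ∃ j, v i j = 1)
    (hx : IsMNW v x) : IsFair v x := by
  have hpos : ∀ i, 0 < value (v i) (x i) := by
    intro i
    have : NeZero n := ⟨by rintro rfl; exact i.elim0⟩
    have hprod : 0 < ∏ i, value (v i) (x i) :=
      (Finset.prod_pos fun i _ => value_pos_of_uniform hv h1 i).trans_le
        (hx.2 _ isAssignment_uniform)
    refine (value_nonneg (hv.nonneg i) (hx.1.nonneg i)).lt_of_ne' ?_
    exact Finset.prod_ne_zero_iff.1 hprod.ne' i (Finset.mem_univ _)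
  refine isFair_of_unimprovable hv hx.1 hpos (fun y hy i hi ha => ?_)
    (fun y hy i k ε hε hlt hi hk ha => ?_)
  · refine absurd (hx.2 y hy) (not_le.2 ?_)
    refine Finset.prod_lt_prod (fun a _ => hpos a) (fun a _ => ?_) ⟨i, Finset.mem_univ _, hi⟩
    by_cases h : a = i
    · rw [h]; exact hi.le
    · exact (ha a h).ge
  · have hki : k ∈ Finset.univ.erase i := by
      refine Finset.mem_erase.2 ⟨?_, Finset.mem_univ _⟩
      rintro rfl
      linarith
    have hsplit : ∀ f : Fin n → ℝ,
        ∏ a, f a = f i * f k * ∏ a ∈ (Finset.univ.erase i).erase k, f a := fun f => by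
      rw [← Finset.mul_prod_erase _ f (Finset.mem_univ i), ← Finset.mul_prod_erase _ f hki,
        mul_assoc]
    have h := hx.2 y hy
    rw [hsplit, hsplit, hi, hk, Finset.prod_congr rfl fun a h =>
      ha a (Finset.mem_erase.1 (Finset.mem_erase.1 h).2).1 (Finset.mem_erase.1 h).1] at h
    have h' := le_of_mul_le_mul_right h (Finset.prod_pos fun a _ => hpos a)
    -- With gap `δ` between the two utilities, the product of the pair changes by `ε * (δ - ε) > 0`.
    nlinarith

/-! ### Leximin by counting entries below a threshold -/

theorem card_sorted_le (v : Fin n → ℝ) (s : ℝ) :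
    (Finset.univ.filter fun j => sorted v j ≤ s).card =
      (Finset.univ.filter fun j => v j ≤ s).card :=
  Finset.card_bij (fun j _ => Tuple.sort v j) 
    (fun j hj => Finset.mem_filter.2 ⟨Finset.mem_univ _, (Finset.mem_filter.1 hj).2⟩)
    (fun a _ b _ h => (Tuple.sort v).injective h)
    (fun b hb => ⟨(Tuple.sort v).symm b, Finset.mem_filter.2 ⟨Finset.mem_univ _, by
      simpa [sorted] using (Finset.mem_filter.1 hb).2⟩, by simp⟩)

theorem sorted_le_iff (v : Fin n → ℝ) (s : ℝ) (j : Fin n) :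
    sorted v j ≤ s ↔ (j : ℕ) < (Finset.univ.filter fun j => v j ≤ s).card := by
  rw [← card_sorted_le]
  exact (Tuple.lt_card_le_iff_apply_le_of_monotone (Tuple.monotone_sort v)).symm

/-- For each `s < t` the two vectors have equally many entries at most `s`, while at `t` itself `v`
has strictly fewer. Comparing counts through `sorted_le_iff` avoids handling the sorting
permutations. -/
theorem leximinDominates_of_threshold {v w : Fin n → ℝ} (t : ℝ) (i : Fin n) (hw : w i ≤ t)
    (hv : t < v i) (h : ∀ a, v a ≤ t ∨ w a < t → v a = w a) : LeximinDominates v w := by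
  have hlt : (Finset.univ.filter fun a => v a ≤ t).card <
      (Finset.univ.filter fun a => w a ≤ t).card := by
    refine Finset.card_lt_card (Finset.ssubset_iff_of_subset ?_ |>.2 ⟨i, by simpa, by simpa⟩)
    intro a ha
    simp only [Finset.mem_filter, Finset.mem_univ, true_and] at ha ⊢
    rwa [← h a (Or.inl ha)]
  have heq : ∀ s < t, ∀ j, sorted v j ≤ s ↔ sorted w j ≤ s := by
    intro s hs j
    rw [sorted_le_iff, sorted_le_iff]
    suffices (Finset.univ.filter fun a => v a ≤ s) = Finset.univ.filter fun a => w a ≤ s by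
      rw [this]
    ext a
    simp only [Finset.mem_filter, Finset.mem_univ, true_and]
    constructor
    · intro ha
      rwa [← h a (Or.inl (ha.trans hs.le))]
    · intro ha
      rwa [h a (Or.inr (ha.trans_lt hs))]
  have hn : (Finset.univ.filter fun a => w a ≤ t).card ≤ n := by
    simpa using Finset.card_le_univ (Finset.univ.filter fun a => w a ≤ t)
  -- The first difference occurs at the index equal to the number of entries of `v` that are at most
  -- `t`.
  refine ⟨⟨_, hlt.trans_le hn⟩, fun j hj => ?_, ?_⟩
  · have hjv : sorted v j ≤ t := (sorted_le_iff v t j).2 hj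
    have hjw : sorted w j ≤ t := (sorted_le_iff w t j).2 (lt_trans hj hlt)
    refine le_antisymm ?_ ?_
    · rcases hjw.eq_or_lt with h | h
      · rwa [h]
      · exact (heq _ h j).2 le_rfl
    · rcases hjv.eq_or_lt with h | h
      · rwa [h]
      · exact (heq _ h j).1 le_rfl
  · refine ((sorted_le_iff w t _).2 hlt).trans_lt (not_le.1 fun hc => ?_)
    exact lt_irrefl _ ((sorted_le_iff v t _).1 hc)

theorem IsLeximin.isFair {v x : Profile n} (hv : IsBinary v) (h1 : ∀ i, ∃ j, v i j = 1)
    (hx : IsLeximin v x) : IsFair v x := by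
  have hpos : ∀ i, 0 < value (v i) (x i) := by
    intro i
    have : NeZero n := ⟨by rintro rfl; exact i.elim0⟩
    by_contra! hle
    refine hx.2 _ isAssignment_uniform (leximinDominates_of_threshold 0 i hle
      (value_pos_of_uniform hv h1 i) ?_)
    rintro a (h | h)
    · exact absurd h (not_le.2 (value_pos_of_uniform hv h1 a))
    · exact absurd h (not_lt.2 (value_nonneg (hv.nonneg a) (hx.1.nonneg a)))
  refine isFair_of_unimprovable hv hx.1 hpos (fun y hy i hi ha => ?_)
    (fun y hy i k ε hε hlt hi hk ha => ?_)
  · refine hx.2 y hy (leximinDominates_of_threshold _ i le_rfl hi fun a h => ha a ?_)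
    rintro rfl
    rcases h with h | h <;> linarith
  -- As `ε` is below the gap, `k` stays above the old utility of `i`, which serves as threshold.
  · refine hx.2 y hy (leximinDominates_of_threshold (value (v i) (x i)) i le_rfl
      (by linarith) fun a h => ha a ?_ ?_)
    · rintro rfl
      rcases h with h | h <;> linarith
    · rintro rfl
      rcases h with h | h <;> linarith

/-! ### CEEI -/

theorem value_update (w a : Fin n → ℝ) (j : Fin n) (c : ℝ) :
    value w (fun l => a l + if l = j then c else 0) = value w a + c * w j := by
  simp [value, add_mul, Finset.sum_add_distrib, ite_mul]

/-- An agent who likes `j` can spend the budget on it and so has utility at least `(p j)⁻¹`. A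
holder of `j` buys at minimum cost, so `j` is a cheapest liked item for her and her utility is at
most `(p j)⁻¹`. -/
theorem IsCEEI.isFair {v x : Profile n} (hv : IsBinary v) (h1 : ∀ i, ∃ j, v i j = 1)
    (hx : IsCEEI v x) : IsFair v x := by
  obtain ⟨hx, p, hp, hdem⟩ := hx
  have hsingle : ∀ (w : Fin n → ℝ) (j : Fin n) (c : ℝ),
      value w (fun l => if l = j then c else 0) = c * w j := by
    intro w j c
    simp [value, ite_mul]
  have hmem : ∀ {j : Fin n} {c : ℝ}, 0 ≤ c → (fun l => if l = j then c else 0) ∈ allocations n := by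
    intro j c hc l
    dsimp only
    split_ifs
    · exact hc
    · exact le_rfl
  have hppos : ∀ i j, v i j = 1 → 0 < p j := by
    intro i j hj
    refine (hp j).lt_of_ne' fun h0 => ?_
    have hU : 0 ≤ value (v i) (x i) := value_nonneg (hv.nonneg i) (hx.nonneg i)
    -- A free liked item could be consumed beyond any utility level.
    have h := (hdem i).2.2.1 _ (hmem (j := j) (c := value (v i) (x i) + 1) (by linarith))
      (by rw [hsingle, h0, mul_zero]; exact zero_le_one)
    rw [hsingle, hj] at h
    linarith
  have hlow : ∀ i j, v i j = 1 → (p j)⁻¹ ≤ value (v i) (x i) := by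
    intro i j hj
    have hpj := hppos i j hj
    have h := (hdem i).2.2.1 _ (hmem (j := j) (c := (p j)⁻¹) (by positivity))
      (by rw [hsingle, inv_mul_cancel₀ hpj.ne'])
    rwa [hsingle, hj, mul_one] at h
  have huse : ∀ k j, 0 < x k j → v k j = 0 → ∀ i, v i j = 0 := by
    intro k j hk h0 i
    rcases hv i j with h | hij
    · exact h
    exfalso
    have hpj := hppos i j hij
    -- Dropping the useless but costly item `j` would be cheaper.
    have h := (hdem k).2.2.2 (fun l => x k l + if l = j then -x k j else 0) ?_ ?_
    · rw [value_update] at h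
      nlinarith
    · intro l
      dsimp only
      split_ifs with hl
      · simp [hl]
      · simpa using hx.nonneg k l
    · rw [value_update, h0, mul_zero, add_zero]
  refine ⟨hx, fun i => ?_, huse, fun i k j hk hij => ?_⟩
  · obtain ⟨j, hj⟩ := h1 i
    exact (inv_pos.2 (hppos i j hj)).trans_le (hlow i j hj)
  · refine le_trans ?_ (hlow i j hij)
    have hpj := hppos i j hij
    have hkj : v k j = 1 := by
      rcases hv k j with h | h
      · simpa [hij] using huse k j hk h i
      · exact h
    have hmin : ∀ l, v k l = 1 → p j ≤ p l := by
      intro l hl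
      -- Replace the whole share of `j` by the same amount of `l`.
      have h := (hdem k).2.2.2
        (fun m => (x k m + if m = j then -x k j else 0) + if m = l then x k j else 0) ?_ ?_
      · rw [value_update, value_update] at h
        nlinarith
      · intro m
        have := hx.nonneg k m
        dsimp only
        split_ifs with hm hm' hm'
        · rw [hm]; linarith
        · rw [hm]; linarith
        · linarith
        · linarith
      · rw [value_update, value_update, hkj, hl]
        linarith
    have hcost : value (v k) (x k) * p j ≤ 1 := by
      refine le_trans ?_ (hdem k).2.1
      rw [value, Finset.sum_mul]
      refine Finset.sum_le_sum fun l _ => ?_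
      rw [mul_assoc]
      refine mul_le_mul_of_nonneg_left ?_ (hx.nonneg k l)
      rcases hv k l with h | h
      · simpa [h] using hp l
      · simpa [h] using hmin l h
    rwa [← one_div, le_div_iff₀ hpj]

end HZReduction

namespace HZReduction

/-! ### Total correctness of programs -/

/-- Started in `σ`, the program `P` halts within `T` steps in a state satisfying `Q`. -/
def Runs (P : Prog) (σ : State) (T : ℕ) (Q : State → Prop) : Prop :=
  ∃ t τ, Exec P σ t τ ∧ t ≤ T ∧ Q τ

theorem Runs.mono {P : Prog} {σ : State} {T T' : ℕ} {Q Q' : State → Prop} (h : Runs P σ T Q)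
    (hT : T ≤ T') (hQ : ∀ τ, Q τ → Q' τ) : Runs P σ T' Q' := by
  obtain ⟨t, τ, he, ht, hq⟩ := h
  exact ⟨t, τ, he, ht.trans hT, hQ τ hq⟩

theorem Runs.skip {σ : State} {Q : State → Prop} (h : Q σ) : Runs .skip σ 1 Q :=
  ⟨1, σ, .skip σ, le_rfl, h⟩

theorem Runs.instr {i : Instr} {σ : State} {Q : State → Prop} (h : Q (i.run σ)) :
    Runs (.instr i) σ 1 Q :=
  ⟨1, _, .instr i σ, le_rfl, h⟩

theorem Runs.seq {P P' : Prog} {σ : State} {s t : ℕ} {R Q : State → Prop} (h : Runs P σ s R)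
    (h' : ∀ τ, R τ → Runs P' τ t Q) : Runs (.seq P P') σ (s + t) Q := by
  obtain ⟨s', τ, he, hs, hr⟩ := h
  obtain ⟨t', ρ, he', ht, hq⟩ := h' τ hr
  exact ⟨_, ρ, he.seq he', add_le_add hs ht, hq⟩

theorem Runs.branch {b : Test} {P P' : Prog} {σ : State} {t : ℕ} {Q : State → Prop}
    (h : b.Holds σ → Runs P σ t Q) (h' : ¬ b.Holds σ → Runs P' σ t Q) :
    Runs (.branch b P P') σ (t + 1) Q := by
  by_cases hb : b.Holds σ
  · obtain ⟨s, τ, he, hs, hq⟩ := h hb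
    exact ⟨_, τ, .branch_true hb he, by omega, hq⟩
  · obtain ⟨s, τ, he, hs, hq⟩ := h' hb
    exact ⟨_, τ, .branch_false hb he, by omega, hq⟩

/-- Let register `r` run from 0 up to the content of register 0. -/
def forLoop (r : ℕ) (P : Prog) : Prog :=
  .seq (.instr (.idxZero r)) (.loop (.idxLt r 0) (.seq P (.instr (.idxInc r))))

/-- Each round adds a test and an increment to the body; the final 2 pays for the initialization and
the failing test. -/
theorem Runs.forLoop {r n T : ℕ} {P : Prog} {σ : State} (Inv : ℕ → State → Prop)
    (h0 : Inv 0 (σ.setIdx r 0)) (hidx : ∀ k τ, Inv k τ → τ.idx r = k ∧ τ.idx 0 = n)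
    (step : ∀ k τ, k < n → Inv k τ →
      Runs P τ T (fun ρ => Inv (k + 1) (ρ.setIdx r (ρ.idx r + 1)))) :
    Runs (forLoop r P) σ (n * (T + 2) + 2) (Inv n) := by
  have hloop : ∀ d k τ, k + d = n → Inv k τ →
      Runs (.loop (.idxLt r 0) (.seq P (.instr (.idxInc r)))) τ (d * (T + 2) + 1) (Inv n) := by
    intro d
    induction d with
    | zero =>
      intro k τ hk hinv
      obtain ⟨h1, h2⟩ := hidx k τ hinv
      obtain rfl : k = n := hk
      exact ⟨1, τ, .loop_false (by simp [Test.Holds, h1, h2]), by omega, hinv⟩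
    | succ d ih =>
      intro k τ hk hinv
      obtain ⟨h1, h2⟩ := hidx k τ hinv
      obtain ⟨s, ρ, he, hs, hρ⟩ := step k τ (by omega) hinv
      obtain ⟨t, π, he', ht, hπ⟩ := ih (k + 1) _ (by omega) hρ
      refine ⟨_, π, .loop_true ?_ (he.seq (.instr _ _)) he', ?_, hπ⟩
      · simp only [Test.Holds, h1, h2]
        omega
      · rw [Nat.succ_mul]
        omega
  exact ((Runs.instr (i := .idxZero r) (Q := Inv 0) h0).seq fun τ hτ => hloop n 0 τ (by omega) hτ).mono
    (by omega) fun _ h => h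

/-! ### Computing the binary-reduced utilities -/

/-- The program computing the binary-reduced utilities: for each row, put the position of a maximal
entry into register 4, then compare all entries with the maximal one. -/
def reduceProg : Prog :=
  forLoop 1 (.seq (.instr (.idxCopy 4 3)) (.seq
    (forLoop 2 (.branch (.numLt ⟨0, 1, 4⟩ ⟨0, 1, 2⟩) (.instr (.idxCopy 4 2)) .skip))
    (forLoop 2 (.branch (.numLt ⟨0, 1, 2⟩ ⟨0, 1, 4⟩)
      (.instr (.numZero ⟨1, 1, 2⟩)) (.instr (.numOne ⟨1, 1, 2⟩))))))

/-- Register 3 is a permanent zero, and row 0 of array 4 must stay clear: the balancing program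
relies on both, using that row as its pool of donated items. -/
structure ReduceState (n i j m : ℕ) (U W : ℕ → ℕ → ℝ) (σ : State) : Prop where
  idx0 : σ.idx 0 = n
  idx1 : σ.idx 1 = i
  idx2 : σ.idx 2 = j
  idx3 : σ.idx 3 = 0
  idx4 : σ.idx 4 = m
  num0 : σ.num 0 = U
  num1 : σ.num 1 = W
  num4 : ∀ l, σ.num 4 0 l = 0

namespace ReduceState

variable {n i j m k : ℕ} {U W : ℕ → ℕ → ℝ} {σ : State}

theorem setIdx1 (h : ReduceState n i j m U W σ) : ReduceState n k j m U W (σ.setIdx 1 k) := by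
  constructor <;> simp [State.setIdx, h.idx0, h.idx2, h.idx3, h.idx4, h.num0, h.num1, h.num4]

theorem setIdx2 (h : ReduceState n i j m U W σ) : ReduceState n i k m U W (σ.setIdx 2 k) := by
  constructor <;> simp [State.setIdx, h.idx0, h.idx1, h.idx3, h.idx4, h.num0, h.num1, h.num4]

theorem setIdx4 (h : ReduceState n i j m U W σ) : ReduceState n i j k U W (σ.setIdx 4 k) := by
  constructor <;> simp [State.setIdx, h.idx0, h.idx1, h.idx2, h.idx3, h.num0, h.num1, h.num4]

theorem set (h : ReduceState n i j m U W σ) (c : ℝ) :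
    ReduceState n i j m U (Function.update W i (Function.update (W i) j c))
      (σ.set ⟨1, 1, 2⟩ c) := by
  constructor <;>
    simp [State.set, h.idx0, h.idx1, h.idx2, h.idx3, h.idx4, h.num0, h.num1, h.num4]
  ext a b
  by_cases ha : a = i
  · subst ha
    by_cases hb : b = j <;> simp [hb]
  · simp [ha]

end ReduceState

theorem runs_argmax {n i j m : ℕ} {U W : ℕ → ℕ → ℝ} {σ : State}
    (h : ReduceState n i j m U W σ) (hm : m < n) :
    Runs (forLoop 2 (.branch (.numLt ⟨0, 1, 4⟩ ⟨0, 1, 2⟩) (.instr (.idxCopy 4 2)) .skip)) σ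
      (n * 4 + 2) (fun τ => ∃ m < n, ReduceState n i n m U W τ ∧ ∀ l < n, U i l ≤ U i m) := by
  refine Runs.forLoop (T := 2)
    (fun k τ => ∃ m < n, ReduceState n i k m U W τ ∧ ∀ l < k, U i l ≤ U i m)
    ⟨m, hm, h.setIdx2, by simp⟩ (fun k τ ⟨_, _, hτ, _⟩ => ⟨hτ.idx2, hτ.idx0⟩) ?_
  rintro k τ hk ⟨m, hm, hτ, hle⟩
  have htest : Test.Holds (.numLt ⟨0, 1, 4⟩ ⟨0, 1, 2⟩) τ ↔ U i m < U i k := by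
    simp [Test.Holds, State.get, hτ.num0, hτ.idx1, hτ.idx2, hτ.idx4]
  refine Runs.branch (fun hb => Runs.instr ?_) (fun hb => Runs.skip ?_)
  · rw [htest] at hb
    simp only [Instr.run]
    rw [hτ.idx2, show (τ.setIdx 4 k).idx 2 = k from hτ.idx2]
    refine ⟨k, hk, hτ.setIdx4.setIdx2, fun l hl => ?_⟩
    rcases Nat.lt_succ_iff_lt_or_eq.1 hl with h | rfl
    · exact (hle l h).trans hb.le
    · exact le_rfl
  · rw [htest, not_lt] at hb
    rw [hτ.idx2]
    refine ⟨m, hm, hτ.setIdx2, fun l hl => ?_⟩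
    rcases Nat.lt_succ_iff_lt_or_eq.1 hl with h | rfl
    · exact hle l h
    · exact hb

theorem runs_compare {n i j m : ℕ} {U W : ℕ → ℕ → ℝ} {σ : State}
    (h : ReduceState n i j m U W σ) :
    Runs (forLoop 2 (.branch (.numLt ⟨0, 1, 2⟩ ⟨0, 1, 4⟩)
      (.instr (.numZero ⟨1, 1, 2⟩)) (.instr (.numOne ⟨1, 1, 2⟩)))) σ
      (n * 4 + 2) (fun τ => ∃ w : ℕ → ℝ, ReduceState n i n m U (Function.update W i w) τ ∧
        ∀ l < n, w l = if U i l < U i m then 0 else 1) := by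
  refine Runs.forLoop (T := 2)
    (fun k τ => ∃ w : ℕ → ℝ, ReduceState n i k m U (Function.update W i w) τ ∧
        ∀ l < k, w l = if U i l < U i m then 0 else 1)
    ⟨W i, by simpa using h.setIdx2, by simp⟩ (fun k τ ⟨_, hτ, _⟩ => ⟨hτ.idx2, hτ.idx0⟩) ?_
  rintro k τ hk ⟨w, hτ, hw⟩
  have htest : Test.Holds (.numLt ⟨0, 1, 2⟩ ⟨0, 1, 4⟩) τ ↔ U i k < U i m := by
    simp [Test.Holds, State.get, hτ.num0, hτ.idx1, hτ.idx2, hτ.idx4]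
  have key : ∀ c : ℝ, (c = if U i k < U i m then 0 else 1) →
      ∃ w : ℕ → ℝ, ReduceState n i (k + 1) m U (Function.update W i w)
        ((τ.set ⟨1, 1, 2⟩ c).setIdx 2 ((τ.set ⟨1, 1, 2⟩ c).idx 2 + 1)) ∧
        ∀ l < k + 1, w l = if U i l < U i m then 0 else 1 := by
    intro c hc
    rw [show (τ.set ⟨1, 1, 2⟩ c).idx 2 = k from hτ.idx2]
    refine ⟨Function.update w k c, by simpa using (hτ.set c).setIdx2, fun l hl => ?_⟩
    rcases Nat.lt_succ_iff_lt_or_eq.1 hl with h | rfl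
    · rw [Function.update_of_ne h.ne, hw l h]
    · rw [Function.update_self, hc]
  refine Runs.branch (fun hb => Runs.instr (key 0 ?_)) (fun hb => Runs.instr (key 1 ?_))
  · rw [if_pos (htest.1 hb)]
  · rw [if_neg (mt htest.2 hb)]

open Classical in
theorem runs_reduceProg {n i j m : ℕ} {U W : ℕ → ℕ → ℝ} {σ : State}
    (h : ReduceState n i j m U W σ) :
    Runs reduceProg σ (n * (8 * n + 7) + 2) (fun τ => ∃ j m W, ReduceState n n j m U W τ ∧
      ∀ i < n, ∀ l < n, W i l = if ∀ l' < n, U i l' ≤ U i l then 1 else 0) := by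
  refine (Runs.forLoop (T := 1 + ((n * 4 + 2) + (n * 4 + 2)))
    (fun k τ => ∃ j m W, ReduceState n k j m U W τ ∧
      ∀ i < k, ∀ l < n, W i l = if ∀ l' < n, U i l' ≤ U i l then 1 else 0)
    ⟨j, m, W, h.setIdx1, by simp⟩ (fun k τ ⟨_, _, _, hτ, _⟩ => ⟨hτ.idx1, hτ.idx0⟩) ?_).mono
    (by nlinarith) fun _ h => h
  rintro k τ hk ⟨j, m, W, hτ, hW⟩
  -- Column 0 is a valid first candidate because `k < n` makes the row nonempty.
  refine Runs.seq (R := ReduceState n k j 0 U W) (Runs.instr ?_) fun τ hτ =>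
    (runs_argmax hτ (by omega)).seq ?_
  · simp only [Instr.run]
    rw [hτ.idx3]
    exact hτ.setIdx4
  rintro τ ⟨m, hm, hτ, hmax⟩
  refine (runs_compare hτ).mono le_rfl ?_
  rintro τ ⟨w, hτ, hw⟩
  rw [hτ.idx1]
  refine ⟨n, m, _, hτ.setIdx1, fun i hi l hl => ?_⟩
  rcases Nat.lt_succ_iff_lt_or_eq.1 hi with h | rfl
  · rw [Function.update_of_ne h.ne, hW i h l hl]
  · rw [Function.update_self, hw l hl]
    by_cases hlt : U i l < U i m
    · rw [if_pos hlt, if_neg fun h => absurd (h m hm) (not_le.2 hlt)]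
    · rw [if_neg hlt, if_pos fun l' hl' => (hmax l' hl').trans (not_lt.1 hlt)]

end HZReduction

namespace HZReduction

/-! ### Computing a balanced assignment -/

/-- Move the minimum of the contents of `a` and of the budget (array 5) from `a` to `b`, and deduct
it from the budget. -/
def moveProg (a b : Cell) : Prog :=
  .branch (.numLt a ⟨5, 3, 3⟩)
    (.seq (.instr (.numPlus b b a))
      (.seq (.instr (.numMinus ⟨5, 3, 3⟩ ⟨5, 3, 3⟩ a)) (.instr (.numZero a))))
    (.seq (.instr (.numPlus b b ⟨5, 3, 3⟩))
      (.seq (.instr (.numMinus a a ⟨5, 3, 3⟩)) (.instr (.numZero ⟨5, 3, 3⟩))))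

/-- Copy row `x i` to row `y i` and compute its size. -/
def copyRowProg : Prog :=
  .seq (.instr (.numZero ⟨5, 3, 3⟩))
    (forLoop 2 (.seq (.instr (.numCopy ⟨3, 1, 2⟩ ⟨2, 1, 2⟩))
      (.instr (.numPlus ⟨5, 3, 3⟩ ⟨5, 3, 3⟩ ⟨2, 1, 2⟩))))

/-- Replace the size by the excess over 1. -/
def excessProg : Prog :=
  .branch (.numLt ⟨5, 3, 3⟩ ⟨6, 3, 3⟩) (.instr (.numZero ⟨5, 3, 3⟩))
    (.instr (.numMinus ⟨5, 3, 3⟩ ⟨5, 3, 3⟩ ⟨6, 3, 3⟩))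

/-- Give away the excess, first of the less preferred items. -/
def giveRowProg : Prog :=
  .seq copyRowProg (.seq excessProg (.seq
    (forLoop 2 (.branch (.numLt ⟨1, 1, 2⟩ ⟨6, 3, 3⟩) (moveProg ⟨3, 1, 2⟩ ⟨4, 3, 2⟩) .skip))
    (forLoop 2 (moveProg ⟨3, 1, 2⟩ ⟨4, 3, 2⟩))))

/-- Compute what is missing for size 1 and take it from the donated items. -/
def takeRowProg : Prog :=
  .seq (.instr (.numCopy ⟨5, 3, 3⟩ ⟨6, 3, 3⟩)) (.seq
    (forLoop 2 (.instr (.numMinus ⟨5, 3, 3⟩ ⟨5, 3, 3⟩ ⟨3, 1, 2⟩)))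
    (forLoop 2 (moveProg ⟨4, 3, 2⟩ ⟨3, 1, 2⟩)))

/-- The program for the balancing operation. -/
def balanceProg : Prog :=
  .seq (.instr (.numOne ⟨6, 3, 3⟩)) (.seq (forLoop 1 giveRowProg) (forLoop 1 takeRowProg))

/-- `V` holds the reduced utilities, `X` the solver's answer, `Y` the result under construction, `P`
the pool of donated items and `e` the current budget; array 6 supplies the constant 1. -/
structure BalanceState (n i j : ℕ) (V X Y : ℕ → ℕ → ℝ) (P : ℕ → ℝ) (e : ℝ) (σ : State) :
    Prop where
  idx0 : σ.idx 0 = n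
  idx1 : σ.idx 1 = i
  idx2 : σ.idx 2 = j
  idx3 : σ.idx 3 = 0
  num1 : σ.num 1 = V
  num2 : σ.num 2 = X
  num3 : σ.num 3 = Y
  num4 : σ.num 4 0 = P
  num5 : σ.num 5 0 0 = e
  num6 : σ.num 6 0 0 = 1

/-! ### Effect of the elementary steps of the balancing program -/

namespace BalanceState

variable {n i j k : ℕ} {V X Y : ℕ → ℕ → ℝ} {P : ℕ → ℝ} {e : ℝ} {σ : State}

theorem setIdx1 (h : BalanceState n i j V X Y P e σ) :
    BalanceState n k j V X Y P e (σ.setIdx 1 k) := by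
  constructor <;> simp [State.setIdx, h.idx0, h.idx2, h.idx3, h.num1, h.num2, h.num3, h.num4,
    h.num5, h.num6]

theorem setIdx2 (h : BalanceState n i j V X Y P e σ) :
    BalanceState n i k V X Y P e (σ.setIdx 2 k) := by
  constructor <;> simp [State.setIdx, h.idx0, h.idx1, h.idx3, h.num1, h.num2, h.num3, h.num4,
    h.num5, h.num6]

theorem set3 (h : BalanceState n i j V X Y P e σ) (c : ℝ) :
    BalanceState n i j V X (Function.update Y i (Function.update (Y i) j c)) P e
      (σ.set ⟨3, 1, 2⟩ c) := by
  constructor <;>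
    simp [State.set, h.idx0, h.idx1, h.idx2, h.idx3, h.num1, h.num2, h.num3, h.num4, h.num5,
      h.num6]
  ext a b
  by_cases ha : a = i
  · subst ha
    by_cases hb : b = j <;> simp [hb]
  · simp [ha]

theorem set4 (h : BalanceState n i j V X Y P e σ) (c : ℝ) :
    BalanceState n i j V X Y (Function.update P j c) e (σ.set ⟨4, 3, 2⟩ c) := by
  constructor <;>
    simp [State.set, h.idx0, h.idx1, h.idx2, h.idx3, h.num1, h.num2, h.num3, h.num4, h.num5,
      h.num6]
  ext b
  by_cases hb : b = j <;> simp [hb]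

theorem set5 (h : BalanceState n i j V X Y P e σ) (c : ℝ) :
    BalanceState n i j V X Y P c (σ.set ⟨5, 3, 3⟩ c) := by
  constructor <;>
    simp [State.set, h.idx0, h.idx1, h.idx2, h.idx3, h.num1, h.num2, h.num3, h.num4, h.num6]

theorem get1 (h : BalanceState n i j V X Y P e σ) : σ.get ⟨1, 1, 2⟩ = V i j := by
  simp [State.get, h.idx1, h.idx2, h.num1]

theorem get2 (h : BalanceState n i j V X Y P e σ) : σ.get ⟨2, 1, 2⟩ = X i j := by
  simp [State.get, h.idx1, h.idx2, h.num2]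

theorem get3 (h : BalanceState n i j V X Y P e σ) : σ.get ⟨3, 1, 2⟩ = Y i j := by
  simp [State.get, h.idx1, h.idx2, h.num3]

theorem get4 (h : BalanceState n i j V X Y P e σ) : σ.get ⟨4, 3, 2⟩ = P j := by
  simp [State.get, h.idx2, h.idx3, h.num4]

theorem get5 (h : BalanceState n i j V X Y P e σ) : σ.get ⟨5, 3, 3⟩ = e := by
  simp [State.get, h.idx3, h.num5]

theorem get6 (h : BalanceState n i j V X Y P e σ) : σ.get ⟨6, 3, 3⟩ = 1 := by
  simp [State.get, h.idx3, h.num6]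

theorem runs_give (h : BalanceState n i j V X Y P e σ) :
    Runs (moveProg ⟨3, 1, 2⟩ ⟨4, 3, 2⟩) σ 4
      (BalanceState n i j V X
        (Function.update Y i (Function.update (Y i) j (Y i j - min (Y i j) e)))
        (Function.update P j (P j + min (Y i j) e)) (e - min (Y i j) e)) := by
  refine Runs.branch (t := 1 + (1 + 1)) (fun hb => ?_) (fun hb => ?_)
  · have hlt : Y i j < e := by simpa [Test.Holds, h.get3, h.get5] using hb
    rw [min_eq_left hlt.le, sub_self]
    have h1 := h.set4 (P j + Y i j)
    have h2 := h1.set5 (e - Y i j)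
    refine .seq (R := (· = σ.set ⟨4, 3, 2⟩ (P j + Y i j))) (.instr ?_) ?_
    · simp [Instr.run, h.get3, h.get4]
    rintro _ rfl
    refine .seq (R := (· = (σ.set ⟨4, 3, 2⟩ (P j + Y i j)).set ⟨5, 3, 3⟩ (e - Y i j)))
      (.instr ?_) ?_
    · simp [Instr.run, h1.get3, h1.get5]
    rintro _ rfl
    exact .instr (h2.set3 0)
  · have hlt : e ≤ Y i j := by simpa [Test.Holds, h.get3, h.get5] using hb
    rw [min_eq_right hlt, sub_self]
    have h1 := h.set4 (P j + e)
    have h2 := h1.set3 (Y i j - e)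
    refine .seq (R := (· = σ.set ⟨4, 3, 2⟩ (P j + e))) (.instr ?_) ?_
    · simp [Instr.run, h.get5, h.get4]
    rintro _ rfl
    refine .seq (R := (· = (σ.set ⟨4, 3, 2⟩ (P j + e)).set ⟨3, 1, 2⟩ (Y i j - e)))
      (.instr ?_) ?_
    · simp [Instr.run, h1.get3, h1.get5]
    rintro _ rfl
    exact .instr (h2.set5 0)

theorem runs_take (h : BalanceState n i j V X Y P e σ) :
    Runs (moveProg ⟨4, 3, 2⟩ ⟨3, 1, 2⟩) σ 4
      (BalanceState n i j V X
        (Function.update Y i (Function.update (Y i) j (Y i j + min (P j) e)))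
        (Function.update P j (P j - min (P j) e)) (e - min (P j) e)) := by
  refine Runs.branch (t := 1 + (1 + 1)) (fun hb => ?_) (fun hb => ?_)
  · have hlt : P j < e := by simpa [Test.Holds, h.get4, h.get5] using hb
    rw [min_eq_left hlt.le, sub_self]
    have h1 := h.set3 (Y i j + P j)
    have h2 := h1.set5 (e - P j)
    refine .seq (R := (· = σ.set ⟨3, 1, 2⟩ (Y i j + P j))) (.instr ?_) ?_
    · simp [Instr.run, h.get3, h.get4]
    rintro _ rfl
    refine .seq (R := (· = (σ.set ⟨3, 1, 2⟩ (Y i j + P j)).set ⟨5, 3, 3⟩ (e - P j)))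
      (.instr ?_) ?_
    · simp [Instr.run, h1.get4, h1.get5]
    rintro _ rfl
    exact .instr (h2.set4 0)
  · have hlt : e ≤ P j := by simpa [Test.Holds, h.get4, h.get5] using hb
    rw [min_eq_right hlt, sub_self]
    have h1 := h.set3 (Y i j + e)
    have h2 := h1.set4 (P j - e)
    refine .seq (R := (· = σ.set ⟨3, 1, 2⟩ (Y i j + e))) (.instr ?_) ?_
    · simp [Instr.run, h.get3, h.get5]
    rintro _ rfl
    refine .seq (R := (· = (σ.set ⟨3, 1, 2⟩ (Y i j + e)).set ⟨4, 3, 2⟩ (P j - e)))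
      (.instr ?_) ?_
    · simp [Instr.run, h1.get4, h1.get5]
    rintro _ rfl
    exact .instr (h2.set5 0)

theorem runs_copyRow (h : BalanceState n i j V X Y P e σ) :
    Runs copyRowProg σ (n * 4 + 3) (fun τ => ∃ a : ℕ → ℝ,
      BalanceState n i n V X (Function.update Y i a) P (∑ l ∈ Finset.range n, X i l) τ ∧
      ∀ l < n, a l = X i l) := by
  refine (Runs.seq (R := BalanceState n i j V X Y P 0)
    (Runs.instr (i := .numZero ⟨5, 3, 3⟩) (h.set5 0)) fun τ hτ =>
    Runs.forLoop (n := n) (T := 1 + 1) (fun k τ => ∃ a : ℕ → ℝ,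
      BalanceState n i k V X (Function.update Y i a) P (∑ l ∈ Finset.range k, X i l) τ ∧
      ∀ l < k, a l = X i l) ⟨Y i, by simpa using hτ.setIdx2, by simp⟩
      (fun k τ ⟨_, hτ, _⟩ => ⟨hτ.idx2, hτ.idx0⟩) ?_).mono (by omega) fun _ h => h
  rintro k τ hk ⟨a, hτ, ha⟩
  have h1 := hτ.set3 (X i k)
  have h2 := h1.set5 (∑ l ∈ Finset.range k, X i l + X i k)
  refine .seq (R := (· = τ.set ⟨3, 1, 2⟩ (X i k))) (.instr ?_) ?_
  · simp [Instr.run, hτ.get2]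
  rintro _ rfl
  refine .instr ?_
  simp only [Instr.run, h1.get5, h1.get2]
  rw [h2.idx2]
  refine ⟨Function.update a k (X i k), ?_, fun l hl => ?_⟩
  · rw [Finset.sum_range_succ]
    simpa using h2.setIdx2
  · rcases Nat.lt_succ_iff_lt_or_eq.1 hl with h | rfl
    · rw [Function.update_of_ne h.ne, ha l h]
    · rw [Function.update_self]

theorem runs_excess (h : BalanceState n i j V X Y P e σ) :
    Runs excessProg σ 2 (BalanceState n i j V X Y P (max (e - 1) 0)) := by
  refine Runs.branch (fun hb => .instr ?_) (fun hb => .instr ?_)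
  · have hlt : e < 1 := by simpa [Test.Holds, h.get6, h.get5] using hb
    rw [max_eq_right (by linarith)]
    exact h.set5 0
  · have hle : 1 ≤ e := by simpa [Test.Holds, h.get6, h.get5] using hb
    rw [max_eq_left (by linarith)]
    simp only [Instr.run, h.get5, h.get6]
    exact h.set5 _

theorem runs_deficit (h : BalanceState n i j V X Y P e σ) :
    Runs (forLoop 2 (.instr (.numMinus ⟨5, 3, 3⟩ ⟨5, 3, 3⟩ ⟨3, 1, 2⟩))) σ (n * 3 + 2)
      (BalanceState n i n V X Y P (e - ∑ l ∈ Finset.range n, Y i l)) := by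
  refine Runs.forLoop (T := 1) (fun k =>
    BalanceState n i k V X Y P (e - ∑ l ∈ Finset.range k, Y i l)) (by simpa using h.setIdx2)
    (fun k τ hτ => ⟨hτ.idx2, hτ.idx0⟩) fun k τ hk hτ => .instr ?_
  simp only [Instr.run, hτ.get5, hτ.get3]
  rw [Finset.sum_range_succ, ← sub_sub]
  have h1 := hτ.set5 (e - ∑ l ∈ Finset.range k, Y i l - Y i k)
  rw [h1.idx2]
  exact h1.setIdx2

end BalanceState

/-- The source row `a`, the target row `b` and the budget `e` have been changed to `a'`, `b'`, `e'`
by the moves at the positions below `k` that satisfy `g`. -/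
structure Moved (n : ℕ) (g : ℕ → Prop) (k : ℕ) (a b : ℕ → ℝ) (e : ℝ) (a' b' : ℕ → ℝ) (e' : ℝ) :
    Prop where
  add_eq : ∀ l, a' l + b' l = a l + b l
  nonneg : ∀ l < n, 0 ≤ a' l
  le : ∀ l, a' l ≤ a l
  budget_nonneg : 0 ≤ e'
  sum_sub : ∑ l ∈ Finset.range n, (a l - a' l) = e - e'
  exhausted : e' = 0 ∨ ∀ l < k, g l → a' l = 0
  unchanged : ∀ l, ¬ g l ∨ k ≤ l → a' l = a l

/-! ### Budgeted moves between a row and the pool -/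

namespace Moved

variable {n k : ℕ} {g : ℕ → Prop} {a b a' b' : ℕ → ℝ} {e e' : ℝ}

theorem refl (ha : ∀ l < n, 0 ≤ a l) (he : 0 ≤ e) : Moved n g 0 a b e a b e where
  add_eq _ := rfl
  nonneg := ha
  le _ := le_rfl
  budget_nonneg := he
  sum_sub := by simp
  exhausted := .inr fun l hl => absurd hl (Nat.not_lt_zero l)
  unchanged _ _ := rfl

theorem skip (h : Moved n g k a b e a' b' e') (hg : ¬ g k) :
    Moved n g (k + 1) a b e a' b' e' where
  add_eq := h.add_eq
  nonneg := h.nonneg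
  le := h.le
  budget_nonneg := h.budget_nonneg
  sum_sub := h.sum_sub
  exhausted := h.exhausted.imp_right fun h l hl hgl => by
    rcases Nat.lt_succ_iff_lt_or_eq.1 hl with hlt | rfl
    · exact h l hlt hgl
    · exact absurd hgl hg
  unchanged l hl := h.unchanged l (hl.imp_right fun h => by omega)

theorem move (h : Moved n g k a b e a' b' e') (hk : k < n) (hg : g k) :
    Moved n g (k + 1) a b e (Function.update a' k (a' k - min (a' k) e'))
      (Function.update b' k (b' k + min (a' k) e')) (e' - min (a' k) e') := by
  have hmin : 0 ≤ min (a' k) e' := le_min (h.nonneg k hk) h.budget_nonneg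
  refine ⟨fun l => ?_, fun l hl => ?_, fun l => ?_, ?_, ?_, ?_, fun l hl => ?_⟩
  · by_cases hl : l = k
    · subst hl
      simp only [Function.update_self]
      linarith [h.add_eq l]
    · simpa [hl] using h.add_eq l
  · by_cases hlk : l = k
    · subst hlk
      simp
    · simpa [hlk] using h.nonneg l hl
  · by_cases hlk : l = k
    · subst hlk
      simp only [Function.update_self]
      linarith [h.le l]
    · simpa [hlk] using h.le l
  · simp
  · have : ∀ l, a l - Function.update a' k (a' k - min (a' k) e') l =
        (a l - a' l) + if l = k then min (a' k) e' else 0 := by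
      intro l
      by_cases hlk : l = k
      · subst hlk
        simp only [Function.update_self, if_true]
        ring
      · simp [hlk]
    simp only [this, Finset.sum_add_distrib, h.sum_sub, Finset.sum_ite_eq', Finset.mem_range, hk,
      if_true]
    ring
  -- A move of the minimum exhausts either the budget or position `k`.
  · rcases le_total e' (a' k) with hle | hle
    · left
      rw [min_eq_right hle, sub_self]
    · rcases h.exhausted with h0 | h0
      · left
        have := h.nonneg k hk
        rw [min_eq_left hle]
        linarith
      · right
        intro l hl hgl
        rcases Nat.lt_succ_iff_lt_or_eq.1 hl with hlt | rfl
        · rw [Function.update_of_ne hlt.ne, h0 l hlt hgl]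
        · rw [Function.update_self, min_eq_left hle, sub_self]
  · have hlk : l ≠ k := by
      rintro rfl
      rcases hl with hl | hl
      · exact hl hg
      · omega
    rw [Function.update_of_ne hlk]
    exact h.unchanged l (hl.imp_right fun h => by omega)

theorem budget_le (h : Moved n g k a b e a' b' e') : e' ≤ e := by
  have := Finset.sum_nonneg (s := Finset.range n) (f := fun l => a l - a' l)
    fun l _ => sub_nonneg.2 (h.le l)
  linarith [h.sum_sub]

theorem eq_of_budget_eq (h : Moved n g k a b e a' b' e') (he : e = e') {l : ℕ} (hl : l < n) :
    a' l = a l := by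
  have h0 := h.sum_sub
  rw [he, sub_self, Finset.sum_eq_zero_iff_of_nonneg fun l _ => sub_nonneg.2 (h.le l)] at h0
  linarith [h0 l (Finset.mem_range.2 hl)]

end Moved

namespace BalanceState

variable {n i j k : ℕ} {V X Y : ℕ → ℕ → ℝ} {P : ℕ → ℝ} {e : ℝ} {σ : State}

theorem runs_give_guarded {a : ℕ → ℝ}
    (h : BalanceState n i j V X (Function.update Y i a) P e σ)
    (ha : ∀ l < n, 0 ≤ a l) (he : 0 ≤ e) :
    Runs (forLoop 2 (.branch (.numLt ⟨1, 1, 2⟩ ⟨6, 3, 3⟩) (moveProg ⟨3, 1, 2⟩ ⟨4, 3, 2⟩) .skip)) σ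
      (n * 7 + 2) (fun τ => ∃ a' P' e',
        BalanceState n i n V X (Function.update Y i a') P' e' τ ∧
        Moved n (fun l => V i l < 1) n a P e a' P' e') := by
  refine Runs.forLoop (T := 4 + 1) (fun k τ => ∃ a' P' e',
        BalanceState n i k V X (Function.update Y i a') P' e' τ ∧
        Moved n (fun l => V i l < 1) k a P e a' P' e')
    ⟨a, P, e, h.setIdx2, .refl ha he⟩ (fun k τ ⟨_, _, _, hτ, _⟩ => ⟨hτ.idx2, hτ.idx0⟩) ?_
  rintro k τ hk ⟨a', P', e', hτ, hm⟩
  have htest : Test.Holds (.numLt ⟨1, 1, 2⟩ ⟨6, 3, 3⟩) τ ↔ V i k < 1 := by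
    simp [Test.Holds, hτ.get1, hτ.get6]
  refine .branch (fun hb => hτ.runs_give.mono le_rfl fun ρ hρ => ?_) fun hb =>
    (Runs.skip ?_ : Runs _ _ 1 _).mono (by omega) fun _ h => h
  · rw [hρ.idx2]
    exact ⟨_, _, _, by simpa using hρ.setIdx2, hm.move hk (htest.1 hb)⟩
  · rw [hτ.idx2]
    exact ⟨_, _, _, hτ.setIdx2, hm.skip (mt htest.2 hb)⟩

theorem runs_give_all {a : ℕ → ℝ}
    (h : BalanceState n i j V X (Function.update Y i a) P e σ)
    (ha : ∀ l < n, 0 ≤ a l) (he : 0 ≤ e) :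
    Runs (forLoop 2 (moveProg ⟨3, 1, 2⟩ ⟨4, 3, 2⟩)) σ
      (n * 6 + 2) (fun τ => ∃ a' P' e',
        BalanceState n i n V X (Function.update Y i a') P' e' τ ∧
        Moved n (fun _ => True) n a P e a' P' e') := by
  refine Runs.forLoop (T := 4) (fun k τ => ∃ a' P' e',
        BalanceState n i k V X (Function.update Y i a') P' e' τ ∧
        Moved n (fun _ => True) k a P e a' P' e')
    ⟨a, P, e, h.setIdx2, .refl ha he⟩ (fun k τ ⟨_, _, _, hτ, _⟩ => ⟨hτ.idx2, hτ.idx0⟩) ?_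
  rintro k τ hk ⟨a', P', e', hτ, hm⟩
  refine hτ.runs_give.mono le_rfl fun ρ hρ => ?_
  rw [hρ.idx2]
  exact ⟨_, _, _, by simpa using hρ.setIdx2, hm.move hk trivial⟩

theorem runs_take_all (h : BalanceState n i j V X Y P e σ)
    (hP : ∀ l < n, 0 ≤ P l) (he : 0 ≤ e) :
    Runs (forLoop 2 (moveProg ⟨4, 3, 2⟩ ⟨3, 1, 2⟩)) σ
      (n * 6 + 2) (fun τ => ∃ a' P' e',
        BalanceState n i n V X (Function.update Y i a') P' e' τ ∧
        Moved n (fun _ => True) n P (Y i) e P' a' e') := by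
  refine Runs.forLoop (T := 4) (fun k τ => ∃ a' P' e',
        BalanceState n i k V X (Function.update Y i a') P' e' τ ∧
        Moved n (fun _ => True) k P (Y i) e P' a' e')
    ⟨Y i, P, e, by simpa using h.setIdx2, .refl hP he⟩
    (fun k τ ⟨_, _, _, hτ, _⟩ => ⟨hτ.idx2, hτ.idx0⟩) ?_
  rintro k τ hk ⟨a', P', e', hτ, hm⟩
  refine hτ.runs_take.mono le_rfl fun ρ hρ => ?_
  rw [hρ.idx2]
  exact ⟨_, _, _, by simpa using hρ.setIdx2, hm.move hk trivial⟩

end BalanceState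

/-- Row `y` arises from row `x` by giving away the excess over size 1, less preferred items
first. -/
structure RowReduced (n : ℕ) (v x y : ℕ → ℝ) : Prop where
  nonneg : ∀ l < n, 0 ≤ y l
  le : ∀ l < n, y l ≤ x l
  eq_of_small : ∑ l ∈ Finset.range n, x l ≤ 1 → ∀ l < n, y l = x l
  size_of_large : 1 ≤ ∑ l ∈ Finset.range n, x l → ∑ l ∈ Finset.range n, y l = 1
  least_first : ∀ j < n, ∀ l < n, v l < 1 → ¬ v j < 1 → y j < x j → y l = 0

/-- The first pass touches only less preferred items. A preferred item can change only in the second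
pass, hence only if budget was left over, and then the first pass had emptied all less preferred
positions. -/
theorem RowReduced.of_moved {n : ℕ} {v x b y₁ b₁ y₂ b₂ : ℕ → ℝ} {e₁ e₂ : ℝ}
    (h₁ : Moved n (fun l => v l < 1) n x b (max (∑ l ∈ Finset.range n, x l - 1) 0) y₁ b₁ e₁)
    (h₂ : Moved n (fun _ => True) n y₁ b₁ e₁ y₂ b₂ e₂) : RowReduced n v x y₂ where
  nonneg := h₂.nonneg
  le l _ := (h₂.le l).trans (h₁.le l)
  eq_of_small hs l hl := by
    have h0 : max (∑ l ∈ Finset.range n, x l - 1) 0 = 0 := max_eq_right (by linarith)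
    have := h₁.budget_le
    have := h₂.budget_le
    have := h₁.budget_nonneg
    have := h₂.budget_nonneg
    rw [h₂.eq_of_budget_eq (by linarith) hl, h₁.eq_of_budget_eq (by linarith) hl]
  size_of_large hs := by
    have h0 : max (∑ l ∈ Finset.range n, x l - 1) 0 = ∑ l ∈ Finset.range n, x l - 1 :=
      max_eq_left (by linarith)
    have s₁ := h₁.sum_sub
    have s₂ := h₂.sum_sub
    rw [Finset.sum_sub_distrib] at s₁ s₂
    have hnn := h₂.budget_nonneg
    rcases h₂.exhausted with h | h
    · linarith
    -- An emptied row would have lost its full size, more than the excess.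
    · have : ∑ l ∈ Finset.range n, y₂ l = 0 :=
        Finset.sum_eq_zero fun l hl => h l (Finset.mem_range.1 hl) trivial
      linarith
  least_first j hj l hl hvl hvj hlt := by
    rw [← h₁.unchanged j (.inl hvj)] at hlt
    rcases h₁.exhausted with h | h
    · refine absurd (h₂.eq_of_budget_eq ?_ hj) hlt.ne
      linarith [h₂.budget_le, h₂.budget_nonneg]
    · exact le_antisymm ((h₂.le l).trans (h l hl hvl).le) (h₂.nonneg l hl)

/-! ### Processing whole rows and matrices -/

namespace BalanceState

variable {n i j k : ℕ} {V X Y : ℕ → ℕ → ℝ} {P : ℕ → ℝ} {e : ℝ} {σ : State}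

theorem runs_giveRow (h : BalanceState n i j V X Y P e σ) (hX : ∀ l < n, 0 ≤ X i l) :
    Runs giveRowProg σ (n * 17 + 9) (fun τ => ∃ y P' e',
      BalanceState n i n V X (Function.update Y i y) P' e' τ ∧
      RowReduced n (V i) (X i) y ∧ ∀ l < n, P l ≤ P' l ∧ y l + P' l = X i l + P l) := by
  refine (h.runs_copyRow.seq (t := 2 + ((n * 7 + 2) + (n * 6 + 2))) ?_).mono (by omega)
    fun _ h => h
  rintro τ ⟨a, hτ, ha⟩
  refine hτ.runs_excess.seq fun τ hτ => ?_
  refine (hτ.runs_give_guarded (fun l hl => by rw [ha l hl]; exact hX l hl)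
    (le_max_right _ _)).seq ?_
  rintro τ ⟨y₁, P₁, e₁, hτ, h₁⟩
  refine (hτ.runs_give_all h₁.nonneg h₁.budget_nonneg).mono le_rfl ?_
  rintro τ ⟨y₂, P₂, e₂, hτ, h₂⟩
  have hsum : ∑ l ∈ Finset.range n, X i l = ∑ l ∈ Finset.range n, a l :=
    Finset.sum_congr rfl fun l hl => (ha l (Finset.mem_range.1 hl)).symm
  rw [hsum] at h₁
  have hr := RowReduced.of_moved h₁ h₂
  refine ⟨y₂, P₂, e₂, hτ, ⟨hr.nonneg, fun l hl => ha l hl ▸ hr.le l hl, fun hs l hl => ?_,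
    fun hs => hr.size_of_large (hsum ▸ hs), fun j hj l hl hvl hvj hlt =>
      hr.least_first j hj l hl hvl hvj ((ha j hj).symm ▸ hlt)⟩, fun l hl => ?_⟩
  · rw [← ha l hl]
    exact hr.eq_of_small (hsum ▸ hs) l hl
  · rw [← ha l hl]
    have := h₁.add_eq l
    have := h₂.add_eq l
    have := h₁.le l
    have := h₂.le l
    constructor <;> linarith

theorem runs_giveRows (h : BalanceState n i j V X Y P e σ)
    (hX : ∀ i < n, ∀ l < n, 0 ≤ X i l) (hcol : ∀ l < n, ∑ i ∈ Finset.range n, X i l = 1)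
    (hP : ∀ l, P l = 0) :
    Runs (forLoop 1 giveRowProg) σ (n * (n * 17 + 11) + 2) (fun τ => ∃ j Y P e,
      BalanceState n n j V X Y P e τ ∧ (∀ l < n, 0 ≤ P l) ∧
      (∀ l < n, P l + ∑ i ∈ Finset.range n, Y i l = 1) ∧
      ∀ i < n, RowReduced n (V i) (X i) (Y i)) := by
  -- Conservation is stated for the first `k` rows only, since later rows have not been copied yet.
  refine (Runs.forLoop (n := n) (T := n * 17 + 9) (fun k τ => ∃ j Y P e,
      BalanceState n k j V X Y P e τ ∧ (∀ l < n, 0 ≤ P l) ∧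
      (∀ l < n, P l + ∑ i ∈ Finset.range k, Y i l = ∑ i ∈ Finset.range k, X i l) ∧
      ∀ i < k, RowReduced n (V i) (X i) (Y i))
    ⟨j, Y, P, e, h.setIdx1, fun l _ => (hP l).ge, by simp [hP], by simp⟩
    (fun k τ ⟨_, _, _, _, hτ, _⟩ => ⟨hτ.idx1, hτ.idx0⟩) ?_).mono (le_of_eq (by ring)) ?_
  · rintro k τ hk ⟨j, Y, P, e, hτ, hP, hs, hr⟩
    refine (hτ.runs_giveRow (hX k hk)).mono le_rfl ?_
    rintro ρ ⟨y, P', e', hρ, hy, hP'⟩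
    rw [hρ.idx1]
    refine ⟨n, _, P', e', hρ.setIdx1, fun l hl => (hP l hl).trans (hP' l hl).1, fun l hl => ?_,
      fun a ha => ?_⟩
    · rw [Finset.sum_range_succ, Finset.sum_range_succ, Function.update_self, ← hs l hl,
        Finset.sum_congr rfl fun a ha => by
          rw [Function.update_of_ne (Finset.mem_range.1 ha).ne]]
      linarith [(hP' l hl).2]
    · rcases Nat.lt_succ_iff_lt_or_eq.1 ha with h | rfl
      · rw [Function.update_of_ne h.ne]
        exact hr a h
      · rwa [Function.update_self]
  · rintro τ ⟨j, Y, P, e, hτ, hP, hs, hr⟩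
    exact ⟨j, Y, P, e, hτ, hP, fun l hl => (hs l hl).trans (hcol l hl), hr⟩

theorem runs_takeRow (h : BalanceState n i j V X Y P e σ) (hP : ∀ l < n, 0 ≤ P l)
    (hY : ∑ l ∈ Finset.range n, Y i l ≤ 1) :
    Runs takeRowProg σ (n * 9 + 5) (fun τ => ∃ y P' e',
      BalanceState n i n V X (Function.update Y i y) P' e' τ ∧
      (∀ l < n, 0 ≤ P' l ∧ P' l ≤ P l ∧ y l + P' l = Y i l + P l) ∧
      ∑ l ∈ Finset.range n, y l ≤ 1 ∧
      (∑ l ∈ Finset.range n, y l = 1 ∨ ∀ l < n, P' l = 0)) := by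
  refine (Runs.seq (R := BalanceState n i j V X Y P 1) (t := (n * 3 + 2) + (n * 6 + 2))
    (.instr ?_) fun τ hτ => ?_).mono (by omega) fun _ h => h
  · simp only [Instr.run, h.get6]
    exact h.set5 1
  refine hτ.runs_deficit.seq fun τ hτ => ?_
  refine (hτ.runs_take_all hP (by linarith)).mono le_rfl ?_
  rintro τ ⟨y, P', e', hτ, hm⟩
  have hy : ∀ l, y l = Y i l + (P l - P' l) := fun l => by linarith [hm.add_eq l]
  have hsum : ∑ l ∈ Finset.range n, y l = 1 - e' := by
    simp only [hy, Finset.sum_add_distrib, hm.sum_sub]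
    ring
  refine ⟨y, P', e', hτ, fun l hl => ⟨hm.nonneg l hl, hm.le l, by linarith [hy l]⟩, ?_, ?_⟩
  · linarith [hm.budget_nonneg]
  · rcases hm.exhausted with h | h
    · left; linarith
    · exact .inr fun l hl => h l hl trivial

/-- The invariant is that the pool is empty or all processed rows are full. Since the total is `n`
and no row exceeds 1, an empty pool forces all rows to be full, and full rows force the pool to be
empty. -/
theorem runs_takeRows (h : BalanceState n i j V X Y P e σ) (hP : ∀ l < n, 0 ≤ P l)
    (hcol : ∀ l < n, P l + ∑ i ∈ Finset.range n, Y i l = 1)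
    (hY : ∀ i < n, ∑ l ∈ Finset.range n, Y i l ≤ 1) :
    Runs (forLoop 1 takeRowProg) σ (n * (n * 9 + 7) + 2) (fun τ =>
      (∀ i < n, ∑ l ∈ Finset.range n, τ.num 3 i l = 1) ∧
      (∀ l < n, ∑ i ∈ Finset.range n, τ.num 3 i l = 1) ∧
      ∀ i < n, ∀ l < n, Y i l ≤ τ.num 3 i l) := by
  refine (Runs.forLoop (n := n) (T := n * 9 + 5) (fun k τ => ∃ j Y' P e,
      BalanceState n k j V X Y' P e τ ∧ (∀ l < n, 0 ≤ P l) ∧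
      (∀ l < n, P l + ∑ i ∈ Finset.range n, Y' i l = 1) ∧
      (∀ i < n, ∀ l < n, Y i l ≤ Y' i l) ∧
      (∀ i < n, ∑ l ∈ Finset.range n, Y' i l ≤ 1) ∧
      ((∀ l < n, P l = 0) ∨ ∀ i < k, ∑ l ∈ Finset.range n, Y' i l = 1))
    ⟨j, Y, P, e, h.setIdx1, hP, hcol, fun _ _ _ _ => le_rfl, hY, .inr (by simp)⟩
    (fun k τ ⟨_, _, _, _, hτ, _⟩ => ⟨hτ.idx1, hτ.idx0⟩) ?_).mono (le_of_eq (by ring)) ?_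
  · rintro k τ hk ⟨j, Y', P, e, hτ, hP, hcol, hle, hY, hdone⟩
    refine (hτ.runs_takeRow hP (hY k hk)).mono le_rfl ?_
    rintro ρ ⟨y, P', e', hρ, hP', hy, hy1⟩
    rw [hρ.idx1]
    refine ⟨n, _, P', e', hρ.setIdx1, fun l hl => (hP' l hl).1, fun l hl => ?_,
      fun a ha l hl => ?_, fun a ha => ?_, ?_⟩
    · have hmem := Finset.mem_range.2 hk
      rw [← hcol l hl, ← Finset.add_sum_erase _ _ hmem, ← Finset.add_sum_erase _ _ hmem,
        Function.update_self, Finset.sum_congr rfl fun a ha => by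
          rw [Function.update_of_ne (Finset.mem_erase.1 ha).1]]
      linarith [(hP' l hl).2.2]
    · by_cases hak : a = k
      · subst hak
        rw [Function.update_self]
        linarith [(hP' l hl).2.1, (hP' l hl).2.2, hle a ha l hl]
      · rw [Function.update_of_ne hak]
        exact hle a ha l hl
    · by_cases hak : a = k
      · rwa [hak, Function.update_self]
      · rw [Function.update_of_ne hak]
        exact hY a ha
    · rcases hy1 with hy1 | h0
      · refine hdone.imp (fun h l hl => ?_) fun h a ha => ?_
        · exact le_antisymm ((hP' l hl).2.1.trans (h l hl).le) (hP' l hl).1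
        · rcases Nat.lt_succ_iff_lt_or_eq.1 ha with hlt | rfl
          · rw [Function.update_of_ne hlt.ne]
            exact h a hlt
          · rwa [Function.update_self]
      · exact .inl h0
  · rintro τ ⟨j, Y', P, e, hτ, hP, hcol, hle, hY, hdone⟩
    rw [hτ.num3]
    have htot : ∑ l ∈ Finset.range n, P l + ∑ i ∈ Finset.range n, ∑ l ∈ Finset.range n, Y' i l
        = n := by
      rw [Finset.sum_comm, ← Finset.sum_add_distrib,
        Finset.sum_congr rfl fun l hl => hcol l (Finset.mem_range.1 hl)]
      simp
    have hrows : ∀ i < n, ∑ l ∈ Finset.range n, Y' i l = 1 := by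
      rcases hdone with h | h
      · rw [Finset.sum_eq_zero fun l hl => h l (Finset.mem_range.1 hl), zero_add] at htot
        have hz : ∑ i ∈ Finset.range n, (1 - ∑ l ∈ Finset.range n, Y' i l) = 0 := by
          rw [Finset.sum_sub_distrib, htot]
          simp
        rw [Finset.sum_eq_zero_iff_of_nonneg fun i hi =>
          sub_nonneg.2 (hY i (Finset.mem_range.1 hi))] at hz
        intro i hi
        linarith [hz i (Finset.mem_range.2 hi)]
      · exact h
    have hP0 : ∑ l ∈ Finset.range n, P l = 0 := by
      rw [Finset.sum_congr rfl fun i hi => hrows i (Finset.mem_range.1 hi)] at htot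
      simpa using htot
    rw [Finset.sum_eq_zero_iff_of_nonneg fun l hl => hP l (Finset.mem_range.1 hl)] at hP0
    exact ⟨hrows, fun l hl => by linarith [hcol l hl, hP0 l (Finset.mem_range.2 hl)], hle⟩

end BalanceState

theorem runs_balanceProg {n : ℕ} {V X : ℕ → ℕ → ℝ} {σ : State} (h0 : σ.idx 0 = n)
    (h3 : σ.idx 3 = 0) (hV : σ.num 1 = V) (hx : σ.num 2 = X) (h4 : ∀ l, σ.num 4 0 l = 0)
    (hX : ∀ i < n, ∀ l < n, 0 ≤ X i l) (hcol : ∀ l < n, ∑ i ∈ Finset.range n, X i l = 1) :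
    Runs balanceProg σ (26 * n ^ 2 + 18 * n + 5) (fun τ => ∃ Y : ℕ → ℕ → ℝ,
      (∀ i < n, RowReduced n (V i) (X i) (Y i)) ∧
      (∀ i < n, ∑ l ∈ Finset.range n, τ.num 3 i l = 1) ∧
      (∀ l < n, ∑ i ∈ Finset.range n, τ.num 3 i l = 1) ∧
      ∀ i < n, ∀ l < n, Y i l ≤ τ.num 3 i l) := by
  -- The contents of array 3 and of the budget cell are arbitrary; both are overwritten before use.
  have hinit : BalanceState n (σ.idx 1) (σ.idx 2) V X (σ.num 3) (σ.num 4 0) (σ.num 5 0 0)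
      (σ.set ⟨6, 3, 3⟩ 1) := by
    constructor <;> simp [State.set, h0, h3, hV, hx]
  refine (Runs.seq (R := (· = σ.set ⟨6, 3, 3⟩ 1)) (.instr rfl)
    (t := (n * (n * 17 + 11) + 2) + (n * (n * 9 + 7) + 2)) ?_).mono (by nlinarith) fun _ h => h
  rintro _ rfl
  refine (hinit.runs_giveRows hX hcol h4).seq ?_
  rintro τ ⟨j, Y, P, e, hτ, hP, hs, hr⟩
  refine (hτ.runs_takeRows hP hs fun i hi => ?_).mono le_rfl fun ρ hρ => ⟨Y, hr, hρ⟩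
  rcases le_total (∑ l ∈ Finset.range n, X i l) 1 with h | h
  · rwa [Finset.sum_congr rfl fun l hl => (hr i hi).eq_of_small h l (Finset.mem_range.1 hl)]
  · exact ((hr i hi).size_of_large h).le

end HZReduction

namespace HZReduction

/-! ### The programs on stored matrices -/

variable {n : ℕ}

theorem store_num_self (σ : State) (a : ℕ) (x : Profile n) (i l : Fin n) :
    (σ.store a x).num a i l = x i l := by
  simp [State.store]

theorem reduceState_init (u : Profile n) :
    ReduceState n 0 0 0 ((State.init u).num 0) (fun _ _ => 0) (State.init u) := by
  constructor <;> simp [State.init, State.store]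

open Classical in
theorem binaryReduced_eq_ite_init (u : Profile n) (i l : Fin n) :
    binaryReduced u i l =
      if ∀ l' < n, (State.init u).num 0 i l' ≤ (State.init u).num 0 i l then 1 else 0 := by
  have hu : ∀ k : Fin n, (State.init u).num 0 i k = u i k := store_num_self _ 0 u i
  have : MostPreferred u i l ↔
      ∀ l' < n, (State.init u).num 0 i l' ≤ (State.init u).num 0 i l := by
    rw [hu]
    exact ⟨fun h l' hl' => (hu ⟨l', hl'⟩).trans_le (h ⟨l', hl'⟩),
      fun h k => (hu k).ge.trans (h k k.2)⟩
  simp only [binaryReduced, this]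

theorem runs_balanceProg_store {u v x : Profile n} {b d : Fin n → ℝ} {σ : State}
    (hv : IsBinary v) (hd : ∀ i, 0 < d i) (hu : ∀ i j, u i j = b i + d i * v i j)
    (h0 : σ.idx 0 = n) (h3 : σ.idx 3 = 0) (h1 : σ.read n 1 = v) (h4 : ∀ l, σ.num 4 0 l = 0)
    (hx : IsAssignment x) :
    Runs balanceProg (σ.store 2 x) (26 * n ^ 2 + 18 * n + 5)
      (fun τ => IsBalancing u x (τ.read n 3)) := by
  set X := (σ.store 2 x).num 2
  have hX : ∀ i l : Fin n, X i l = x i l := store_num_self σ 2 x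
  have hV : ∀ i l : Fin n, (σ.store 2 x).num 1 i l = v i l := by
    intro i l
    rw [← h1]
    simp [State.store, State.read]
  have hsize : ∀ i : Fin n, ∑ l ∈ Finset.range n, X i l = size (x i) := fun i => by
    rw [Finset.sum_range]
    exact Finset.sum_congr rfl fun l _ => hX i l
  refine (runs_balanceProg (X := X) (σ := σ.store 2 x) h0 h3 rfl rfl
    (fun l => by simpa [State.store] using h4 l)
    (fun i hi l hl => (hx.nonneg ⟨i, hi⟩ ⟨l, hl⟩).trans_eq (hX ⟨i, hi⟩ ⟨l, hl⟩).symm)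
    (fun l hl => ?_)).mono le_rfl ?_
  · rw [Finset.sum_range, ← hx.col_sum ⟨l, hl⟩]
    exact Finset.sum_congr rfl fun i _ => hX i ⟨l, hl⟩
  rintro τ ⟨Y, hr, hrow, hcol, hle⟩
  have hle' : ∀ i l : Fin n, Y i l ≤ τ.read n 3 i l := fun i l => hle i i.2 l l.2
  have hnn : ∀ i l : Fin n, 0 ≤ τ.read n 3 i l := fun i l =>
    ((hr i i.2).nonneg l l.2).trans (hle' i l)
  have hcol' : ∀ l : Fin n, ∑ i : Fin n, τ.read n 3 i l = 1 := fun l => by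
    rw [← hcol l l.2, Finset.sum_range]
    rfl
  have hrow' : ∀ i : Fin n, size (τ.read n 3 i) = 1 := fun i => by
    rw [← hrow i i.2, Finset.sum_range]
    rfl
  -- Such a row already has size 1 after giving; taking never decreases an entry, so equal sums
  -- force equal entries.
  have hlarge : ∀ i, 1 ≤ size (x i) → ∀ l : Fin n, τ.read n 3 i l = Y i l := by
    intro i hi l
    have hYs := (hr i i.2).size_of_large ((hsize i).symm ▸ hi)
    rw [← hrow i i.2] at hYs
    exact ((Finset.sum_eq_sum_iff_of_le fun l hl => hle i i.2 l (Finset.mem_range.1 hl)).1 hYs l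
      (Finset.mem_range.2 l.2)).symm
  refine ⟨⟨hnn, fun i l => ?_, hcol'⟩, hrow', fun i hi l => ?_, fun i hi l k hul hlt => ?_,
    fun i hi l => ?_⟩
  · rw [← hcol' l]
    exact Finset.single_le_sum (f := fun i => τ.read n 3 i l) (fun i _ => hnn i l)
      (Finset.mem_univ i)
  · rw [hlarge i hi, ← hX]
    exact (hr i i.2).le l l.2
  · rw [hlarge i hi] at hlt ⊢
    have hvlt : v i k < v i l := by
      rw [hu, hu, add_lt_add_iff_left] at hul
      exact lt_of_mul_lt_mul_left hul (hd i).le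
    have hkl : v i k = 0 ∧ v i l = 1 := by
      rcases hv i l with h | h <;> rcases hv i k with h' | h' <;> constructor <;> linarith
    refine (hr i i.2).least_first l l.2 k k.2 ?_ ?_ ((hX i l).symm ▸ hlt)
    · rw [hV, hkl.1]
      exact one_pos
    · rw [hV, hkl.2]
      exact lt_irrefl 1
  · rw [← hX, ← (hr i i.2).eq_of_small ((hsize i).symm ▸ hi) l l.2]
    exact hle' i l

end HZReduction

open HZReduction
/-- A fixed pair of programs reduces the computation of an HZ solution under bi-valued utilities
to a single call of any solver for MNW, CEEI or leximin under 1-0 utilities. The program `pre`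
reads `u` from array 0 and leaves the query in array 1; the solver's answer `x` is placed in
array 2; the program `post` leaves the result in array 3. Both run in time linear in the size
of the input matrix. -/
theorem mainTheorem9 :
    ∃ (pre post : Prog) (C : ℕ), ∀ (n : ℕ) (u : Profile n),
      IsBiValued u → (∀ i, ∃ j, 0 < u i j) →
      (IsBinary (binaryReduced u) ∧ ∀ i, ∃ j, 0 < binaryReduced u i j) ∧
      ∃ (t₁ : ℕ) (σ₁ : State),
        Exec pre (State.init u) t₁ σ₁ ∧
        t₁ ≤ C * (n ^ 2 + 1) ∧
        σ₁.read n 1 = binaryReduced u ∧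
        ∀ x : Profile n,
          (IsMNW (binaryReduced u) x ∨ IsCEEI (binaryReduced u) x ∨
            IsLeximin (binaryReduced u) x) →
          (∃ (t₂ : ℕ) (σ₂ : State),
            Exec post (σ₁.store 2 x) t₂ σ₂ ∧
            t₂ ≤ C * (n ^ 2 + 1) ∧
            IsBalancing u x (σ₂.read n 3) ∧
            IsHZ u (σ₂.read n 3)) ∧
          (∀ y : Profile n, IsBalancing u x y → IsHZ u y) := by
  -- Any constant dominating both explicit quadratic step bounds would do; 100 is generous.
  refine ⟨reduceProg, balanceProg, 100, fun n u hu _ => ?_⟩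
  have hv := isBinary_binaryReduced u
  have h1 := exists_binaryReduced_eq_one u
  obtain ⟨b, d, hd, hbd⟩ := hu.exists_affine
  refine ⟨⟨hv, fun i => (h1 i).imp fun j hj => by rw [hj]; exact one_pos⟩, ?_⟩
  obtain ⟨t₁, σ₁, he₁, ht₁, j, m, W, hσ₁, hW⟩ := runs_reduceProg (reduceState_init u)
  have hread : σ₁.read n 1 = binaryReduced u := by
    ext i l
    rw [State.read, hσ₁.num1, hW i i.2 l l.2, binaryReduced_eq_ite_init]
  refine ⟨t₁, σ₁, he₁, ht₁.trans (by nlinarith), hread, fun x hx => ?_⟩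
  have hfair : IsFair (binaryReduced u) x := by
    rcases hx with hx | hx | hx
    exacts [hx.isFair hv h1, hx.isFair hv h1, hx.isFair hv h1]
  have hall : ∀ y, IsBalancing u x y → IsHZ u y := fun y hy => hy.isHZ hv hd hbd hfair
  refine ⟨?_, hall⟩
  obtain ⟨t₂, σ₂, he₂, ht₂, hbal⟩ :=
    runs_balanceProg_store hv hd hbd hσ₁.idx0 hσ₁.idx3 hread hσ₁.num4 hfair.assignment
  exact ⟨t₂, σ₂, he₂, ht₂.trans (by nlinarith), hbal, hall _ hbal⟩
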